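/- Let $K$ be an algebraic function field of one variable with full constant field the finite field $\mathbb{F}_q$, let $\infty$ be a place of $K$, let $A$ be the ring of all elements of $K$ that are integral at every place other than $\infty$, and let $G=GL_2(A)$. Let $G$ act by Möbius transformations on $\mathbb{P}^1(K)$, let $\mathrm{Cusp}(G)=G\backslash\mathbb{P}^1(K)$, and for $s\in\mathbb{P}^1(K)$ let $G(s)$ be the stabilizer of $s$ in $G$ and $G[s]=\{gG(s)g^{-1}: g\in G\}$ its conjugacy class. Then: 1. $\mathrm{Cusp}(G)$ is finite and in bijection with the ideal class group $\mathrm{Cl}(A)$. 2. If $G(s)=G(s')$, then $s=s'$; and $G[s]=G[s']$ if and only if $s$ and $s'$ lie in the same $G$-orbit. So $Gs\mapsto G[s]$ identifies $\mathrm{Cusp}(G)$ with the set of conjugacy classes of cusp stabilizers. 3. $\mathrm{Aut}(G)$ acts on $\mathbb{P}^1(K)$ by permutations $\widetilde{\sigma}$ with $\sigma(G(s))=G(\widetilde{\sigma}(s))$ for all $\sigma\in\mathrm{Aut}(G)$ and $s\in\mathbb{P}^1(K)$. 4. Every $\sigma\in\mathrm{Aut}(G)$ induces a well-defined permutation $\sigma^*$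 of $\mathrm{Cusp}(G)$ by its action on the conjugacy classes of cusp stabilizers: $\sigma^*(Gs)=G\,\widetilde{\sigma}(s)$ and $\sigma(G[s])=G[\widetilde{\sigma}(s)]$ for all $s\in\mathbb{P}^1(K)$. The map $\sigma\mapsto\sigma^*$ is a group homomorphism, that is, $\mathrm{Aut}(G)$ acts on $\mathrm{Cusp}(G)$, and this is the only action with these properties. -/

import Mathlib

open scoped LinearAlgebra.Projectivization MatrixGroups

noncomputable section

namespace DrinfeldModular

/-- `K` is an algebraic function field of one variable over `k` whose full constant field is `k`:
`K` is a finite extension of `k(t)` for some `t` transcendental over `k`, and every element of `K`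
that is algebraic over `k` lies in `k`. -/
structure IsFunctionField (k K : Type*) [Field k] [Field K] [Algebra k K] : Prop where
  exists_finite : ∃ t : K, Transcendental k t ∧
    FiniteDimensional (IntermediateField.adjoin k ({t} : Set K)) K
  constants : ∀ x : K, IsAlgebraic k x → ∃ a : k, algebraMap k K a = x

/-- A place of `K / k`, given by its valuation ring: a valuation ring of `K` that contains `k` and
is different from `K`. -/
structure IsPlace (k : Type*) {K : Type*} [Field k] [Field K] [Algebra k K]
    (v : ValuationSubring K) : Prop where
  algebraMap_mem : ∀ a : k, algebraMap k K a ∈ v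
  ne_top : v ≠ ⊤

variable (k : Type*) {K : Type*} [Field k] [Field K] [Algebra k K]

/-- The ring `A` of all elements of `K` that are integral at every place different from `P`. -/
def integralOutside (P : ValuationSubring K) : Subring K :=
  ⨅ v : {v : ValuationSubring K // IsPlace k v ∧ v ≠ P}, v.1.toSubring

theorem mem_integralOutside (P : ValuationSubring K) (x : K) :
    x ∈ integralOutside k P ↔ ∀ v : ValuationSubring K, IsPlace k v → v ≠ P → x ∈ v := by
  simp [integralOutside, Subring.mem_iInf]

/-- `GL₂(A)` acts on the projective line `ℙ¹(K)` through the inclusion `GL₂(A) ≤ GL₂(K)`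
and Möbius transformations. -/
instance actionProjectiveLine (A : Subring K) : MulAction (GL (Fin 2) A) (ℙ K (Fin 2 → K)) :=
  MulAction.compHom _ (Matrix.GeneralLinearGroup.map (n := Fin 2) A.subtype)

theorem smul_def (A : Subring K) (g : GL (Fin 2) A) (s : ℙ K (Fin 2 → K)) :
    g • s = Matrix.GeneralLinearGroup.map (n := Fin 2) A.subtype g • s := rfl

/-- The set of cusps of `GL₂(A)`: its orbits on `ℙ¹(K)`. -/
abbrev Cusp (A : Subring K) : Type _ :=
  MulAction.orbitRel.Quotient (GL (Fin 2) A) (ℙ K (Fin 2 → K))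

/-- The cusp (orbit) of a point of `ℙ¹(K)`. -/
def toCusp (A : Subring K) (s : ℙ K (Fin 2 → K)) : Cusp A :=
  Quotient.mk (MulAction.orbitRel (GL (Fin 2) A) (ℙ K (Fin 2 → K))) s

/-- `G(s)`: the stabilizer in `G = GL₂(A)` of the point `s` of `ℙ¹(K)`. -/
def pointStabilizer (A : Subring K) (s : ℙ K (Fin 2 → K)) : Subgroup (GL (Fin 2) A) :=
  MulAction.stabilizer (GL (Fin 2) A) s

/-- `G[s]`: the conjugacy class in `G = GL₂(A)` of the stabilizer `G(s)`, that is, the set of all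
subgroups `g G(s) g⁻¹` with `g ∈ G`. -/
def stabilizerClass (A : Subring K) (s : ℙ K (Fin 2 → K)) : Set (Subgroup (GL (Fin 2) A)) :=
  {H | ∃ g : GL (Fin 2) A, H = (pointStabilizer A s).map (MulAut.conj g).toMonoidHom}

theorem pointStabilizer_smul (A : Subring K) (g : GL (Fin 2) A) (s : ℙ K (Fin 2 → K)) :
    pointStabilizer A (g • s) = (pointStabilizer A s).map (MulAut.conj g).toMonoidHom :=
  MulAction.stabilizer_smul_eq_stabilizer_map_conj g s

theorem stabilizerClass_smul (A : Subring K) (g : GL (Fin 2) A) (s : ℙ K (Fin 2 → K)) :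
    stabilizerClass A (g • s) = stabilizerClass A s := by
  have key : ∀ h : GL (Fin 2) A, (pointStabilizer A s).map (MulAut.conj h).toMonoidHom =
      pointStabilizer A (h • s) := fun h => (pointStabilizer_smul A h s).symm
  ext H
  constructor
  · rintro ⟨h, rfl⟩
    refine ⟨h * g, ?_⟩
    rw [key, mul_smul, ← pointStabilizer_smul]
  · rintro ⟨h, rfl⟩
    refine ⟨h * g⁻¹, ?_⟩
    rw [key, ← pointStabilizer_smul, mul_smul, inv_smul_smul]

/-- The conjugacy class of stabilizers attached to a cusp: the cusp of `s` is sent to `G[s]`. -/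
def cuspClass (A : Subring K) : Cusp A → Set (Subgroup (GL (Fin 2) A)) :=
  Quotient.lift (stabilizerClass A) (by
    rintro _ s ⟨g, rfl⟩
    exact stabilizerClass_smul A g s)

/-- The image of a set `S` of subgroups of `G` under an automorphism `σ` of `G`:
the set of all `σ(H)` with `H ∈ S`. -/
def mapClass {G : Type*} [Group G] (σ : MulAut G) (S : Set (Subgroup G)) : Set (Subgroup G) :=
  (fun H : Subgroup G => H.map σ.toMonoidHom) '' S

end DrinfeldModular

end

/-! Cusp stabilizers can be recognised inside the abstract group `G`. Let `p` be the characteristic.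
If `g ≠ 1` and `g ^ p = 1`, then `(g - 1) ^ p = 0`, so `g` is unipotent and fixes exactly one point
of the projective line. Two such elements commute exactly when their fixed points agree
(`commute_iff_fixedPoint_eq`). Hence, if `s` is the fixed point of `g`, then `h` lies in `G(s)`
exactly when `h g h⁻¹` commutes with `g`, a condition that every automorphism respects. Every point
arises in this way (`exists_fixing_element`), so stabilizers determine points and automorphisms
permute the stabilizers. The actions on points and on cusps, and the uniqueness, follow formally.

For the class group, send the point `(x : y)` to the class of the fractional ideal `(x, y)`. This is
invariant under `G`. It is injective on orbits because `1 ∈ I * I⁻¹` supplies the matrix joining two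
vectors with the same ideal, and surjective because ideals of a Dedekind domain have two generators.

The longest part shows that `A` is a Dedekind domain with finite class group and fraction field `K`.
It suffices to find a transcendental `t ∈ A` with `K` finite separable over `k(t)`, for then `A` is
the integral closure of `k[t]`. A dimension count in the style of Riemann produces a nonconstant
element of `A` (`exists_transcendental_mem_integralOutside_of_separable`), and extracting `p`-th
roots makes the extension separable (`exists_pow_eq_and_isSeparable`). -/

namespace DrinfeldModular

open Matrix

/-! ### Nilpotent 2 × 2 matrices and their kernels. -/

section UnipotentMatrices

variable {K : Type*} [Field K]

/-- A nilpotent `2 × 2` matrix over a field has square zero. -/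
theorem mul_self_eq_zero_of_isNilpotent {N : Matrix (Fin 2) (Fin 2) K} (hN : IsNilpotent N) :
    N * N = 0 := by
  have htr : N.trace = 0 := (isNilpotent_trace_of_isNilpotent hN).eq_zero
  have hdet : N.det = 0 := by
    obtain ⟨n, hn⟩ := hN
    have : N.det ^ n = 0 := by
      rw [← det_pow, hn]
      rcases n with _ | n
      · simp at hn
      · simp
    exact eq_zero_of_pow_eq_zero this
  rw [trace_fin_two] at htr
  rw [det_fin_two] at hdet
  have h1 : N 1 1 = -N 0 0 := by linear_combination htr
  rw [h1] at hdet
  ext i j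
  fin_cases i <;> fin_cases j <;> simp [mul_apply, Fin.sum_univ_two, h1] <;>
    first | ring1 | linear_combination -hdet

theorem mulVec_eq_zero_of_not_proportional {N : Matrix (Fin 2) (Fin 2) K} {u v : Fin 2 → K}
    (huv : u 0 * v 1 - u 1 * v 0 ≠ 0) (hu : N *ᵥ u = 0) (hv : N *ᵥ v = 0) : N = 0 := by
  have key : ∀ i, N i 0 = 0 ∧ N i 1 = 0 := by
    intro i
    have h1 : N i 0 * u 0 + N i 1 * u 1 = 0 := by
      simpa [mulVec, dotProduct, Fin.sum_univ_two] using congrFun hu i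
    have h2 : N i 0 * v 0 + N i 1 * v 1 = 0 := by
      simpa [mulVec, dotProduct, Fin.sum_univ_two] using congrFun hv i
    constructor
    · refine (mul_eq_zero.1 (?_ : N i 0 * (u 0 * v 1 - u 1 * v 0) = 0)).resolve_right huv
      linear_combination v 1 * h1 - u 1 * h2
    · refine (mul_eq_zero.1 (?_ : N i 1 * (u 0 * v 1 - u 1 * v 0) = 0)).resolve_right huv
      linear_combination u 0 * h2 - v 0 * h1
  ext i j
  fin_cases j
  · exact (key i).1
  · exact (key i).2

theorem proportional_of_cross_eq_zero {u v : Fin 2 → K} (hv : v ≠ 0)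
    (h : u 0 * v 1 - u 1 * v 0 = 0) : ∃ a : K, a • v = u := by
  by_cases h0 : v 0 = 0
  · have h1 : v 1 ≠ 0 := fun h1 => hv (by ext i; fin_cases i <;> simp [h0, h1])
    have h2 : u 0 = 0 := by simpa [h0, h1] using h
    refine ⟨u 1 / v 1, ?_⟩
    ext i
    fin_cases i
    · simp [h0, h2]
    · simp [h1]
  · refine ⟨u 0 / v 0, ?_⟩
    ext i
    fin_cases i
    · simp [h0]
    · simp only [Fin.mk_one, Pi.smul_apply, smul_eq_mul, Fin.isValue]
      field_simp
      linear_combination h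

theorem proportional_of_mulVec_eq_zero {N : Matrix (Fin 2) (Fin 2) K} (hN : N ≠ 0)
    {u v : Fin 2 → K} (hv : v ≠ 0) (hu0 : N *ᵥ u = 0) (hv0 : N *ᵥ v = 0) : ∃ a : K, a • v = u :=
  proportional_of_cross_eq_zero hv <| by
    by_contra h
    exact hN (mulVec_eq_zero_of_not_proportional h hu0 hv0)

end UnipotentMatrices

/-! ### Elements of order `p` and their fixed points. -/

section FixedPoints

variable {K : Type*} [Field K] (A : Subring K)

/-- The matrix over `K` underlying an element of `GL₂(A)`. -/
abbrev toMatrix (g : GL (Fin 2) A) : Matrix (Fin 2) (Fin 2) K :=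
  (Matrix.GeneralLinearGroup.map (n := Fin 2) A.subtype g).val

theorem toMatrix_mul (g h : GL (Fin 2) A) : toMatrix A (g * h) = toMatrix A g * toMatrix A h := by
  simp [toMatrix]

theorem toMatrix_pow (g : GL (Fin 2) A) (n : ℕ) : toMatrix A (g ^ n) = toMatrix A g ^ n := by
  simp only [toMatrix, map_pow, Units.val_pow_eq_pow_val]

theorem toMatrix_one : toMatrix A 1 = 1 := by
  simp only [toMatrix, map_one, Units.val_one]

theorem toMatrix_injective : Function.Injective (toMatrix A) := by
  intro g h hgh
  ext i j
  exact congrFun (congrFun hgh i) j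

theorem smul_mk_eq_mk_iff (g : GL (Fin 2) A) (v w : Fin 2 → K) (hv : v ≠ 0) (hw : w ≠ 0) :
    g • Projectivization.mk K v hv = Projectivization.mk K w hw ↔
      ∃ a : K, a • w = toMatrix A g *ᵥ v := by
  rw [DrinfeldModular.smul_def, Projectivization.smul_mk, Projectivization.mk_eq_mk_iff']
  rfl

variable (p : ℕ) [Fact p.Prime] [CharP K p]

/-- In characteristic `p`, `(g - 1) ^ p = g ^ p - 1 = 0`, so `g - 1` is nilpotent. -/
theorem toMatrix_sub_one_mul_self {g : GL (Fin 2) A} (hg : g ^ p = 1) :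
    (toMatrix A g - 1) * (toMatrix A g - 1) = 0 := by
  refine mul_self_eq_zero_of_isNilpotent ⟨p, ?_⟩
  rw [sub_pow_char_of_commute p (Commute.one_right _), ← toMatrix_pow, hg, toMatrix_one, one_pow,
    sub_self]

theorem toMatrix_sub_one_ne_zero {g : GL (Fin 2) A} (hg : g ≠ 1) : toMatrix A g - 1 ≠ 0 := by
  intro h
  exact hg (toMatrix_injective A (by rw [toMatrix_one]; exact sub_eq_zero.1 h))

/-- For `g` of order `p`, the fixed points are the lines in the kernel of `g - 1`. -/
theorem smul_mk_eq_self_iff {g : GL (Fin 2) A} (hg : g ^ p = 1) (v : Fin 2 → K) (hv : v ≠ 0) :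
    g • Projectivization.mk K v hv = Projectivization.mk K v hv ↔
      (toMatrix A g - 1) *ᵥ v = 0 := by
  rw [smul_mk_eq_mk_iff, sub_mulVec, one_mulVec, sub_eq_zero]
  constructor
  · rintro ⟨a, ha⟩
    have h1 : (toMatrix A g - 1) *ᵥ v = (a - 1) • v := by
      rw [sub_mulVec, one_mulVec, ← ha, sub_smul, one_smul]
    have h2 : (a - 1) • (a - 1) • v = 0 := by
      rw [← h1, ← mulVec_smul, ← h1, mulVec_mulVec, toMatrix_sub_one_mul_self A p hg, zero_mulVec]
    have h3 : a - 1 = 0 := by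
      by_contra h
      exact hv ((smul_eq_zero.1 ((smul_eq_zero.1 h2).resolve_left h)).resolve_left h)
    rw [← ha, sub_eq_zero.1 h3, one_smul]
  · intro h
    exact ⟨1, by rw [h, one_smul]⟩

/-- An element of order `p` of `GL₂(A)` has a unique fixed point on `ℙ¹(K)`. -/
theorem exists_unique_fixedPoint {g : GL (Fin 2) A} (hg : g ^ p = 1) (hg1 : g ≠ 1) :
    ∃ s : ℙ K (Fin 2 → K), ∀ s' : ℙ K (Fin 2 → K), g • s' = s' ↔ s' = s := by
  have hN := toMatrix_sub_one_ne_zero A hg1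
  obtain ⟨w, hw⟩ : ∃ w, (toMatrix A g - 1) *ᵥ w ≠ 0 := by
    by_contra! h
    exact hN (Matrix.ext_of_mulVec_single fun i => by rw [h, zero_mulVec])
  have hv0 : (toMatrix A g - 1) *ᵥ ((toMatrix A g - 1) *ᵥ w) = 0 := by
    rw [mulVec_mulVec, toMatrix_sub_one_mul_self A p hg, zero_mulVec]
  refine ⟨Projectivization.mk K _ hw, fun s' => ?_⟩
  induction s' using Projectivization.ind with
  | h u hu =>
    rw [smul_mk_eq_self_iff A p hg, Projectivization.mk_eq_mk_iff']
    constructor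
    · intro h
      exact proportional_of_mulVec_eq_zero hN hw h hv0
    · rintro ⟨a, rfl⟩
      rw [mulVec_smul, hv0, smul_zero]

/-- Two elements of order `p` commute if and only if they have the same fixed point. -/
theorem commute_iff_fixedPoint_eq {g h : GL (Fin 2) A} (hg : g ^ p = 1)
    (hh : h ^ p = 1) {s s' : ℙ K (Fin 2 → K)}
    (hs : ∀ t : ℙ K (Fin 2 → K), g • t = t ↔ t = s)
    (hs' : ∀ t : ℙ K (Fin 2 → K), h • t = t ↔ t = s') : Commute g h ↔ s = s' := by
  constructor
  · intro hc
    refine (hs' s).1 ((hs _).1 ?_)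
    rw [← mul_smul, hc.eq, mul_smul, (hs s).2 rfl]
  · rintro rfl
    induction s using Projectivization.ind with
    | h v hv =>
      have kerg : (toMatrix A g - 1) *ᵥ v = 0 := (smul_mk_eq_self_iff A p hg v hv).1 ((hs _).2 rfl)
      have kerh : (toMatrix A h - 1) *ᵥ v = 0 := (smul_mk_eq_self_iff A p hh v hv).1 ((hs' _).2 rfl)
      -- If `M ≠ 0`, its image lies in its kernel, which is the line of `v`, and `N` kills that
      -- line. Used both ways, this makes both products of `g - 1` and `h - 1` vanish, so `g` and
      -- `h` commute.
      have key : ∀ {M N : Matrix (Fin 2) (Fin 2) K}, M * M = 0 → M *ᵥ v = 0 → N *ᵥ v = 0 →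
          N * M = 0 := by
        intro M N hM hMv hNv
        by_cases hM0 : M = 0
        · simp [hM0]
        refine Matrix.ext_of_mulVec_single fun i => ?_
        obtain ⟨a, ha⟩ := proportional_of_mulVec_eq_zero hM0 (u := M *ᵥ Pi.single i 1) hv
          (by rw [mulVec_mulVec, hM, zero_mulVec]) hMv
        rw [← mulVec_mulVec, ← ha, mulVec_smul, hNv, smul_zero, zero_mulVec]
      have h1 := key (toMatrix_sub_one_mul_self A p hh) kerh kerg
      have h2 := key (toMatrix_sub_one_mul_self A p hg) kerg kerh
      refine toMatrix_injective A ?_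
      rw [toMatrix_mul, toMatrix_mul]
      have h3 := h1.trans h2.symm
      rw [sub_mul, mul_sub, one_mul, mul_one, sub_mul, mul_sub, one_mul, mul_one] at h3
      rw [← sub_eq_zero] at h3 ⊢
      rw [← h3]
      abel

theorem exists_representative [IsFractionRing A K] (s : ℙ K (Fin 2 → K)) :
    ∃ (x y : A) (h : ![(x : K), (y : K)] ≠ 0), s = Projectivization.mk K _ h := by
  induction s using Projectivization.ind with
  | h v hv =>
    obtain ⟨d, hd⟩ := IsLocalization.exist_integer_multiples_of_finite (nonZeroDivisors A) v
    obtain ⟨x, hx⟩ := hd 0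
    obtain ⟨y, hy⟩ := hd 1
    have hd0 : ((d : A) : K) ≠ 0 := by
      simp
    have key : ((d : A) : K) • v = ![(x : K), (y : K)] := by
      ext i
      fin_cases i
      · exact hx.symm
      · exact hy.symm
    refine ⟨x, y, ?_, ?_⟩
    · rw [← key]
      exact smul_ne_zero hd0 hv
    · rw [Eq.comm, Projectivization.mk_eq_mk_iff']
      exact ⟨_, key⟩

/-- Every point of `ℙ¹(K)` is the fixed point of an element of order `p` of `GL₂(A)`. -/
theorem exists_fixing_element [IsFractionRing A K] (s : ℙ K (Fin 2 → K)) :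
    ∃ g : GL (Fin 2) A, g ^ p = 1 ∧ g ≠ 1 ∧
      ∀ s' : ℙ K (Fin 2 → K), g • s' = s' ↔ s' = s := by
  obtain ⟨x, y, hv, rfl⟩ := exists_representative A s
  -- This is `1` plus the column `(x, y)` times the row `(y, -x)`: a rank-one matrix of square zero
  -- whose kernel is the line of `(x, y)`.
  let M : Matrix (Fin 2) (Fin 2) A := !![1 + x * y, -(x * x); y * y, 1 - x * y]
  have hM : IsUnit M.det := by
    have : M.det = 1 := by simp [M, det_fin_two]; ring
    rw [this]; exact isUnit_one
  obtain ⟨g, hg⟩ : ∃ g : GL (Fin 2) A, g.val = M := ((Matrix.isUnit_iff_isUnit_det M).2 hM)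
  have hgM : toMatrix A g - 1 = !![(x * y : K), -(x * x); y * y, -(x * y)] := by
    ext i j
    fin_cases i <;> fin_cases j <;>
      simp [toMatrix, hg, M]
  have hsq : (toMatrix A g - 1) ^ 2 = 0 := by
    rw [hgM, pow_two]
    ext i j
    fin_cases i <;> fin_cases j <;> simp [mul_apply, Fin.sum_univ_two] <;> ring
  have hgp : g ^ p = 1 := by
    refine toMatrix_injective A ?_
    have h := sub_pow_char_of_commute p (Commute.one_right (toMatrix A g))
    -- Since `p ≥ 2`, square zero already gives `(g - 1) ^ p = 0`.
    rw [← Nat.sub_add_cancel (Fact.out : p.Prime).two_le, pow_add, hsq, mul_zero,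
      Nat.sub_add_cancel (Fact.out : p.Prime).two_le, one_pow] at h
    rw [toMatrix_pow, toMatrix_one]
    exact (sub_eq_zero.1 h.symm)
  have hg1 : g ≠ 1 := by
    intro h
    rw [h, toMatrix_one, sub_self] at hgM
    have hx := congrFun (congrFun hgM 0) 1
    have hy := congrFun (congrFun hgM 1) 0
    simp at hx hy
    exact hv (by simp [hx, hy])
  refine ⟨g, hgp, hg1, ?_⟩
  obtain ⟨s, hs⟩ := exists_unique_fixedPoint A p hgp hg1
  have : g • Projectivization.mk K _ hv = Projectivization.mk K _ hv := by
    rw [smul_mk_eq_self_iff A p hgp, hgM]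
    ext i
    fin_cases i <;> simp [mulVec, dotProduct, Fin.sum_univ_two] <;> ring
  rw [(hs _).1 this]
  exact hs

theorem smul_eq_self_iff_conj {g : GL (Fin 2) A} (h : GL (Fin 2) A) {s : ℙ K (Fin 2 → K)}
    (hs : ∀ t : ℙ K (Fin 2 → K), g • t = t ↔ t = s) (t : ℙ K (Fin 2 → K)) :
    (h * g * h⁻¹) • t = t ↔ t = h • s := by
  rw [mul_smul, mul_smul, smul_eq_iff_eq_inv_smul, hs, inv_smul_eq_iff]

/-- The stabilizer of the fixed point of an element `g` of order `p` consists of the elements `h`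
for which `h g h⁻¹` commutes with `g`. -/
theorem mem_pointStabilizer_iff_commute {g : GL (Fin 2) A} (hg : g ^ p = 1)
    {s : ℙ K (Fin 2 → K)} (hs : ∀ t : ℙ K (Fin 2 → K), g • t = t ↔ t = s) (h : GL (Fin 2) A) :
    h ∈ pointStabilizer A s ↔ Commute (h * g * h⁻¹) g := by
  rw [commute_iff_fixedPoint_eq A p (by rw [conj_pow, hg, mul_one, mul_inv_cancel]) hg
    (smul_eq_self_iff_conj A h hs) hs]
  rfl

/-- `G(s)` contains a unipotent element whose only fixed point is `s`. If it also lies in `G(s')`,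
it fixes `s'`. -/
theorem pointStabilizer_injective (p : ℕ) [Fact p.Prime] [CharP K p] [IsFractionRing A K] :
    Function.Injective (pointStabilizer A) := by
  intro s s' h
  obtain ⟨g, -, -, hs⟩ := exists_fixing_element A p s
  have : g ∈ pointStabilizer A s' := h ▸ (hs s).2 rfl
  exact ((hs s').1 this).symm

/-- The commutation criterion for `G(s)` involves only `g` and the group law, so `σ` turns it into
the criterion for the fixed point of `σ g`. -/
theorem exists_map_pointStabilizer_eq (p : ℕ) [Fact p.Prime] [CharP K p] [IsFractionRing A K] (σ : MulAut (GL (Fin 2) A))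
    (s : ℙ K (Fin 2 → K)) :
    ∃ t : ℙ K (Fin 2 → K), (pointStabilizer A s).map σ.toMonoidHom = pointStabilizer A t := by
  obtain ⟨g, hg, hg1, hs⟩ := exists_fixing_element A p s
  have hσg : σ g ^ p = 1 := by rw [← map_pow, hg, map_one]
  have hσg1 : σ g ≠ 1 := by simpa using hg1
  obtain ⟨t, ht⟩ := exists_unique_fixedPoint A p hσg hσg1
  refine ⟨t, ?_⟩
  ext h
  obtain ⟨h, rfl⟩ := σ.surjective h
  rw [mem_pointStabilizer_iff_commute A p hσg ht, ← map_inv, ← map_mul, ← map_mul,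
    Commute, SemiconjBy, ← map_mul, ← map_mul, σ.injective.eq_iff]
  change _ ↔ Commute (h * g * h⁻¹) g
  rw [← mem_pointStabilizer_iff_commute A p hg hs]
  exact Subgroup.mem_map_iff_mem σ.injective

end FixedPoints

/-! ### Automorphisms acting on points and on cusps. -/

section AutomorphismAction

variable {K : Type*} [Field K] (A : Subring K)

theorem map_pointStabilizer_mul (σ τ : MulAut (GL (Fin 2) A)) (s : ℙ K (Fin 2 → K)) :
    (pointStabilizer A s).map (σ * τ).toMonoidHom =
      ((pointStabilizer A s).map τ.toMonoidHom).map σ.toMonoidHom := by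
  rw [Subgroup.map_map]
  rfl

theorem map_pointStabilizer_one (s : ℙ K (Fin 2 → K)) :
    (pointStabilizer A s).map (1 : MulAut (GL (Fin 2) A)).toMonoidHom = pointStabilizer A s :=
  Subgroup.map_id _

/-- If automorphisms of `GL₂(A)` permute the point stabilizers, and points are determined by their
stabilizers, then the automorphism group acts on `ℙ¹(K)`. -/
theorem exists_action_projectiveLine (hinj : Function.Injective (pointStabilizer A))
    (hmap : ∀ (σ : MulAut (GL (Fin 2) A)) (s : ℙ K (Fin 2 → K)),
      ∃ t, (pointStabilizer A s).map σ.toMonoidHom = pointStabilizer A t) :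
    ∃ τ : MulAut (GL (Fin 2) A) →* Equiv.Perm (ℙ K (Fin 2 → K)),
      ∀ (σ : MulAut (GL (Fin 2) A)) (s : ℙ K (Fin 2 → K)),
        (pointStabilizer A s).map σ.toMonoidHom = pointStabilizer A (τ σ s) := by
  choose f hf using hmap
  let act : MulAction (MulAut (GL (Fin 2) A)) (ℙ K (Fin 2 → K)) :=
    { smul := f
      one_smul := fun s => hinj ((hf 1 s).symm.trans (map_pointStabilizer_one A s))
      mul_smul := fun σ τ s => hinj <| by
        change pointStabilizer A (f (σ * τ) s) = pointStabilizer A (f σ (f τ s))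
        rw [← hf, ← hf, ← hf, map_pointStabilizer_mul] }
  exact ⟨@MulAction.toPermHom _ _ _ act, hf⟩

theorem toCusp_eq_iff {s t : ℙ K (Fin 2 → K)} :
    toCusp A s = toCusp A t ↔ ∃ g : GL (Fin 2) A, g • t = s :=
  Quotient.eq

theorem toCusp_surjective : Function.Surjective (toCusp A) := Quotient.mk_surjective

theorem cuspClass_toCusp (s : ℙ K (Fin 2 → K)) :
    cuspClass A (toCusp A s) = stabilizerClass A s := rfl

theorem mem_stabilizerClass_iff {s : ℙ K (Fin 2 → K)} {H : Subgroup (GL (Fin 2) A)} :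
    H ∈ stabilizerClass A s ↔ ∃ g : GL (Fin 2) A, H = pointStabilizer A (g • s) := by
  simp only [stabilizerClass, Set.mem_ofPred_eq, pointStabilizer_smul]

theorem cuspClass_injective (hinj : Function.Injective (pointStabilizer A)) :
    Function.Injective (cuspClass A) := by
  intro c d hcd
  obtain ⟨s, rfl⟩ := toCusp_surjective A c
  obtain ⟨t, rfl⟩ := toCusp_surjective A d
  have hs : pointStabilizer A s ∈ stabilizerClass A t := by
    rw [← cuspClass_toCusp, ← hcd, cuspClass_toCusp, mem_stabilizerClass_iff]
    exact ⟨1, by rw [one_smul]⟩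
  obtain ⟨g, hg⟩ := (mem_stabilizerClass_iff A).1 hs
  exact (toCusp_eq_iff A).2 ⟨g, (hinj hg).symm⟩

variable {A} {τ : MulAut (GL (Fin 2) A) →* Equiv.Perm (ℙ K (Fin 2 → K))}

/-- Both points have stabilizer `σ(g) σ(G(s)) σ(g)⁻¹`. This twisted equivariance is what lets the
action pass to orbits. -/
theorem action_smul
    (hτ : ∀ (σ : MulAut (GL (Fin 2) A)) (s : ℙ K (Fin 2 → K)),
      (pointStabilizer A s).map σ.toMonoidHom = pointStabilizer A (τ σ s))
    (hinj : Function.Injective (pointStabilizer A))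
    (σ : MulAut (GL (Fin 2) A)) (g : GL (Fin 2) A) (s : ℙ K (Fin 2 → K)) :
    τ σ (g • s) = σ g • τ σ s := by
  refine hinj ?_
  rw [← hτ, pointStabilizer_smul, pointStabilizer_smul, ← hτ, Subgroup.map_map, Subgroup.map_map]
  congr 1
  ext1 h
  simp

theorem mapClass_stabilizerClass
    (hτ : ∀ (σ : MulAut (GL (Fin 2) A)) (s : ℙ K (Fin 2 → K)),
      (pointStabilizer A s).map σ.toMonoidHom = pointStabilizer A (τ σ s))
    (hinj : Function.Injective (pointStabilizer A))
    (σ : MulAut (GL (Fin 2) A)) (s : ℙ K (Fin 2 → K)) :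
    mapClass σ (stabilizerClass A s) = stabilizerClass A (τ σ s) := by
  ext H
  simp only [mapClass, Set.mem_image, mem_stabilizerClass_iff]
  constructor
  · rintro ⟨_, ⟨g, rfl⟩, rfl⟩
    exact ⟨σ g, by rw [hτ, action_smul hτ hinj]⟩
  · rintro ⟨g, rfl⟩
    exact ⟨_, ⟨σ.symm g, rfl⟩, by rw [hτ, action_smul hτ hinj, MulEquiv.apply_symm_apply]⟩

/-- The action on the projective line descends uniquely to an action on the cusps. -/
theorem existsUnique_action_cusp
    (hτ : ∀ (σ : MulAut (GL (Fin 2) A)) (s : ℙ K (Fin 2 → K)),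
      (pointStabilizer A s).map σ.toMonoidHom = pointStabilizer A (τ σ s))
    (hinj : Function.Injective (pointStabilizer A)) :
    ∃! Φ : MulAut (GL (Fin 2) A) →* Equiv.Perm (Cusp A),
      ∀ σ : MulAut (GL (Fin 2) A),
        (∀ c : Cusp A, mapClass σ (cuspClass A c) = cuspClass A (Φ σ c)) ∧
        (∀ s : ℙ K (Fin 2 → K), Φ σ (toCusp A s) = toCusp A (τ σ s)) := by
  let f (σ : MulAut (GL (Fin 2) A)) : Cusp A → Cusp A :=
    Quotient.lift (fun s => toCusp A (τ σ s)) (by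
      rintro _ s ⟨g, rfl⟩
      exact (toCusp_eq_iff A).2 ⟨σ g, (action_smul hτ hinj σ g s).symm⟩)
  have hf (σ) (s : ℙ K (Fin 2 → K)) : f σ (toCusp A s) = toCusp A (τ σ s) := rfl
  let act : MulAction (MulAut (GL (Fin 2) A)) (Cusp A) :=
    { smul := f
      one_smul := fun c => by
        obtain ⟨s, rfl⟩ := toCusp_surjective A c
        change f 1 _ = _
        rw [hf, map_one, Equiv.Perm.one_apply]
      mul_smul := fun σ ρ c => by
        obtain ⟨s, rfl⟩ := toCusp_surjective A c
        change f _ _ = f _ (f _ _)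
        rw [hf, hf, hf, map_mul, Equiv.Perm.mul_apply] }
  refine ⟨@MulAction.toPermHom _ _ _ act, fun σ => ⟨fun c => ?_, hf σ⟩, fun Ψ hΨ => ?_⟩
  · obtain ⟨s, rfl⟩ := toCusp_surjective A c
    exact mapClass_stabilizerClass hτ hinj σ s
  · ext σ c
    obtain ⟨s, rfl⟩ := toCusp_surjective A c
    exact (hΨ σ).2 s

end AutomorphismAction

end DrinfeldModular

namespace DrinfeldModular

open Matrix
open scoped nonZeroDivisors

/-! ### Cusps and ideal classes. -/

section CuspsAndIdealClasses

variable {K : Type*} [Field K]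

theorem classGroup_mk_eq_mk_iff {R : Type*} [CommRing R] [IsDomain R] [Algebra R K]
    [IsFractionRing R K] (I J : (FractionalIdeal R⁰ K)ˣ) :
    ClassGroup.mk K I = ClassGroup.mk K J ↔
      ∃ a : K, a ≠ 0 ∧ (J : FractionalIdeal R⁰ K) = FractionalIdeal.spanSingleton R⁰ a * I := by
  have h : ClassGroup.mk K I = ClassGroup.mk K J ↔ J * I⁻¹ ∈ (toPrincipalIdeal R K).range := by
    have hid (I : (FractionalIdeal R⁰ K)ˣ) :
        ClassGroup.equiv K (ClassGroup.mk K I) = QuotientGroup.mk' _ I := by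
      rw [ClassGroup.equiv_mk]
      congr 1
      ext1
      simp
    rw [← (ClassGroup.equiv K).injective.eq_iff, hid, hid, QuotientGroup.mk'_apply,
      QuotientGroup.mk'_apply, QuotientGroup.eq, mul_comm]
  rw [h]
  constructor
  · rintro ⟨a, ha⟩
    refine ⟨a, a.ne_zero, ?_⟩
    rw [← coe_toPrincipalIdeal, ha, ← Units.val_mul, inv_mul_cancel_right]
  · rintro ⟨a, ha, hJ⟩
    refine ⟨Units.mk0 a ha, ?_⟩
    rw [eq_mul_inv_iff_mul_eq]
    ext1
    rw [Units.val_mul, coe_toPrincipalIdeal, hJ, Units.val_mk0]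

variable (A : Subring K)

theorem toMatrix_apply (g : GL (Fin 2) A) (i j : Fin 2) : toMatrix A g i j = (g.val i j : K) := rfl

variable [IsFractionRing A K]

/-- The fractional ideal generated by the two coordinates of a vector. -/
noncomputable def coordinateIdeal (v : Fin 2 → K) : FractionalIdeal A⁰ K :=
  FractionalIdeal.spanSingleton A⁰ (v 0) + FractionalIdeal.spanSingleton A⁰ (v 1)

theorem mem_coordinateIdeal {v : Fin 2 → K} {z : K} :
    z ∈ coordinateIdeal A v ↔ ∃ a b : A, a * v 0 + b * v 1 = z := by
  simp only [coordinateIdeal, FractionalIdeal.mem_add, FractionalIdeal.mem_spanSingleton]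
  constructor
  · rintro ⟨_, ⟨a, rfl⟩, _, ⟨b, rfl⟩, h⟩
    exact ⟨a, b, h⟩
  · rintro ⟨a, b, h⟩
    exact ⟨_, ⟨a, rfl⟩, _, ⟨b, rfl⟩, h⟩

theorem coordinateIdeal_ne_zero {v : Fin 2 → K} (hv : v ≠ 0) : coordinateIdeal A v ≠ 0 := by
  intro h
  refine hv ?_
  have h0 : v 0 ∈ coordinateIdeal A v := (mem_coordinateIdeal A).2 ⟨1, 0, by simp⟩
  have h1 : v 1 ∈ coordinateIdeal A v := (mem_coordinateIdeal A).2 ⟨0, 1, by simp⟩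
  rw [h, FractionalIdeal.mem_zero_iff] at h0 h1
  ext i
  fin_cases i
  · exact h0
  · exact h1

theorem coordinateIdeal_smul (a : K) (v : Fin 2 → K) :
    coordinateIdeal A (a • v) = FractionalIdeal.spanSingleton A⁰ a * coordinateIdeal A v := by
  simp only [coordinateIdeal, mul_add, FractionalIdeal.spanSingleton_mul_spanSingleton,
    Pi.smul_apply, smul_eq_mul]

theorem coordinateIdeal_mulVec_le (g : GL (Fin 2) A) (v : Fin 2 → K) :
    coordinateIdeal A (toMatrix A g *ᵥ v) ≤ coordinateIdeal A v := by
  intro z hz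
  obtain ⟨a, b, rfl⟩ := (mem_coordinateIdeal A).1 hz
  refine (mem_coordinateIdeal A).2
    ⟨a * g.val 0 0 + b * g.val 1 0, a * g.val 0 1 + b * g.val 1 1, ?_⟩
  simp only [mulVec, dotProduct, Fin.sum_univ_two, toMatrix_apply]
  push_cast
  ring

theorem coordinateIdeal_mulVec (g : GL (Fin 2) A) (v : Fin 2 → K) :
    coordinateIdeal A (toMatrix A g *ᵥ v) = coordinateIdeal A v := by
  refine le_antisymm (coordinateIdeal_mulVec_le A g v) ?_
  have h := coordinateIdeal_mulVec_le A g⁻¹ (toMatrix A g *ᵥ v)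
  rwa [mulVec_mulVec, ← toMatrix_mul, inv_mul_cancel, toMatrix_one, one_mulVec] at h

variable [IsDedekindDomain A]

/-- Fractional ideals of a Dedekind domain are invertible, so `1` lies in `I * I⁻¹`, where `I` is
generated by the coordinates. -/
theorem exists_dual_coordinates {v : Fin 2 → K} (hv : v ≠ 0) :
    ∃ a ∈ (coordinateIdeal A v)⁻¹, ∃ b ∈ (coordinateIdeal A v)⁻¹, v 0 * a + v 1 * b = 1 := by
  have h : (1 : K) ∈ coordinateIdeal A v * (coordinateIdeal A v)⁻¹ := by
    rw [mul_inv_cancel₀ (coordinateIdeal_ne_zero A hv)]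
    exact FractionalIdeal.one_mem_one _
  nth_rewrite 1 [coordinateIdeal] at h
  rw [add_mul, FractionalIdeal.mem_add] at h
  obtain ⟨_, hx, _, hy, h⟩ := h
  obtain ⟨a, ha, rfl⟩ := FractionalIdeal.mem_singleton_mul.1 hx
  obtain ⟨b, hb, rfl⟩ := FractionalIdeal.mem_singleton_mul.1 hy
  exact ⟨a, ha, b, hb, h⟩

/-- Two vectors whose coordinates generate the same fractional ideal differ by an element of
`GL₂(A)`. -/
theorem exists_mulVec_eq_of_coordinateIdeal_eq {v w : Fin 2 → K} (hv : v ≠ 0) (hw : w ≠ 0)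
    (h : coordinateIdeal A v = coordinateIdeal A w) :
    ∃ g : GL (Fin 2) A, toMatrix A g *ᵥ v = w := by
  obtain ⟨a, ha, b, hb, hab⟩ := exists_dual_coordinates A hv
  obtain ⟨c, hc, d, hd, hcd⟩ := exists_dual_coordinates A hw
  have hv0 : v 0 ∈ coordinateIdeal A v := (mem_coordinateIdeal A).2 ⟨1, 0, by simp⟩
  have hv1 : v 1 ∈ coordinateIdeal A v := (mem_coordinateIdeal A).2 ⟨0, 1, by simp⟩
  have hw0 : w 0 ∈ coordinateIdeal A v := h ▸ (mem_coordinateIdeal A).2 ⟨1, 0, by simp⟩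
  have hw1 : w 1 ∈ coordinateIdeal A v := h ▸ (mem_coordinateIdeal A).2 ⟨0, 1, by simp⟩
  rw [← h] at hc hd
  have key : ∀ {x y : K}, x ∈ coordinateIdeal A v → y ∈ (coordinateIdeal A v)⁻¹ →
      x * y ∈ A := by
    intro x y hx hy
    have := FractionalIdeal.mul_mem_mul hx hy
    rw [mul_inv_cancel₀ (coordinateIdeal_ne_zero A hv), FractionalIdeal.mem_one_iff] at this
    obtain ⟨z, hz⟩ := this
    rw [← hz]
    exact z.2
  -- `M` is the column `w` times the row `(a, b)`, plus the column `(d, -c)` times the row `(v 1, -v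
  -- 0)`. The second term kills `v`, so `M v = w`. The determinant is `(v 0 * a + v 1 * b) * (w 0 *
  -- c + w 1 * d) = 1`, and the entries lie in `I * I⁻¹ = A`.
  let M : Matrix (Fin 2) (Fin 2) A :=
    !![⟨w 0 * a + v 1 * d, add_mem (key hw0 ha) (key hv1 hd)⟩,
       ⟨w 0 * b - v 0 * d, sub_mem (key hw0 hb) (key hv0 hd)⟩;
       ⟨w 1 * a - v 1 * c, sub_mem (key hw1 ha) (key hv1 hc)⟩,
       ⟨w 1 * b + v 0 * c, add_mem (key hw1 hb) (key hv0 hc)⟩]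
  have hdet : M.det = 1 := by
    apply Subtype.ext
    simp only [M, det_fin_two_of]
    push_cast
    linear_combination (w 0 * c + w 1 * d) * hab + hcd
  obtain ⟨g, hg⟩ : ∃ g : GL (Fin 2) A, g.val = M :=
    (Matrix.isUnit_iff_isUnit_det M).2 (hdet ▸ isUnit_one)
  refine ⟨g, ?_⟩
  ext i
  fin_cases i
  · simp [mulVec, dotProduct, Fin.sum_univ_two, hg, M]
    linear_combination w 0 * hab
  · simp [mulVec, dotProduct, Fin.sum_univ_two, hg, M]
    linear_combination w 1 * hab

/-- The ideal class attached to a point of the projective line. -/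
noncomputable def pointClass (s : ℙ K (Fin 2 → K)) : ClassGroup A :=
  ClassGroup.mk K (Units.mk0 (coordinateIdeal A s.rep) (coordinateIdeal_ne_zero A s.rep_nonzero))

/-- Rescaling a vector multiplies its ideal by a principal one and `GL₂(A)` preserves the ideal;
conversely, after rescaling, vectors with equal ideals are joined by a matrix. -/
theorem pointClass_eq_iff (s t : ℙ K (Fin 2 → K)) :
    pointClass A s = pointClass A t ↔ ∃ g : GL (Fin 2) A, g • s = t := by
  have hst (g : GL (Fin 2) A) : g • s = t ↔ ∃ a : K, a • t.rep = toMatrix A g *ᵥ s.rep := by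
    rw [← smul_mk_eq_mk_iff A g s.rep t.rep s.rep_nonzero t.rep_nonzero, s.mk_rep, t.mk_rep]
  simp only [hst, pointClass, classGroup_mk_eq_mk_iff, Units.val_mk0]
  constructor
  · rintro ⟨a, ha, h⟩
    rw [← coordinateIdeal_smul] at h
    obtain ⟨g, hg⟩ := exists_mulVec_eq_of_coordinateIdeal_eq A
      (smul_ne_zero ha s.rep_nonzero) t.rep_nonzero h.symm
    refine ⟨g, a⁻¹, ?_⟩
    rw [← hg, mulVec_smul, inv_smul_smul₀ ha]
  · rintro ⟨g, a, h⟩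
    have ha : a ≠ 0 := by
      rintro rfl
      have := congrArg (toMatrix A g⁻¹ *ᵥ ·) h
      simp only [mulVec_mulVec, ← toMatrix_mul, inv_mul_cancel, toMatrix_one, one_mulVec,
        zero_smul, mulVec_zero] at this
      exact s.rep_nonzero this.symm
    refine ⟨a⁻¹, inv_ne_zero ha, ?_⟩
    rw [← coordinateIdeal_mulVec A g s.rep, ← h, coordinateIdeal_smul, ← mul_assoc,
      FractionalIdeal.spanSingleton_mul_spanSingleton, inv_mul_cancel₀ ha,
      FractionalIdeal.spanSingleton_one, one_mul]

theorem pointClass_surjective : Function.Surjective (pointClass A) := by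
  intro c
  refine ClassGroup.induction K (fun I => ?_) c
  have hI : (I : FractionalIdeal A⁰ K) ≠ 0 := I.ne_zero
  obtain ⟨x, hx, hx0⟩ := Submodule.exists_mem_ne_zero_of_ne_bot
    (FractionalIdeal.coeToSubmodule_ne_bot.2 hI)
  -- In a Dedekind domain any nonzero `x ∈ I` is completed by one further element `y` to generators
  -- of `I`.
  obtain ⟨y, hy⟩ := IsDedekindDomain.exists_add_spanSingleton_mul_eq
    (FractionalIdeal.spanSingleton_le_iff_mem.2 hx)
    (FractionalIdeal.spanSingleton_ne_zero_iff.2 hx0) one_ne_zero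
  have hv : ![x, y] ≠ 0 := fun h => hx0 (congrFun h 0)
  refine ⟨Projectivization.mk K _ hv, ?_⟩
  obtain ⟨a, ha⟩ := Projectivization.exists_smul_eq_mk_rep K _ hv
  rw [pointClass, classGroup_mk_eq_mk_iff]
  refine ⟨(a : K)⁻¹, inv_ne_zero a.ne_zero, ?_⟩
  rw [Units.val_mk0, ← ha, Units.smul_def, coordinateIdeal_smul, ← mul_assoc,
    FractionalIdeal.spanSingleton_mul_spanSingleton, inv_mul_cancel₀ a.ne_zero,
    FractionalIdeal.spanSingleton_one, one_mul, ← hy, mul_one]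
  rfl

theorem nonempty_cusp_equiv_classGroup : Nonempty (Cusp A ≃ ClassGroup A) := by
  refine ⟨Equiv.ofBijective (Quotient.lift (pointClass A) ?_) ⟨?_, ?_⟩⟩
  · rintro s t ⟨g, hg⟩
    exact ((pointClass_eq_iff A t s).2 ⟨g, hg⟩).symm
  · rintro ⟨s⟩ ⟨t⟩ h
    obtain ⟨g, hg⟩ := (pointClass_eq_iff A t s).1 h.symm
    exact Quotient.sound ⟨g, hg⟩
  · intro c
    obtain ⟨s, hs⟩ := pointClass_surjective A c
    exact ⟨Quotient.mk _ s, hs⟩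

end CuspsAndIdealClasses

end DrinfeldModular

namespace DrinfeldModular

open scoped IntermediateField

/-! ### Separating elements of a function field. -/

section Separability

open IntermediateField in
/-- A finite extension `K / E` of fields of characteristic `p` with `K = E(K^p)` is separable. -/
theorem isSeparable_of_adjoin_pow_eq_top {E K : Type*} [Field E] [Field K] [Algebra E K]
    [FiniteDimensional E K] (p : ℕ) [Fact p.Prime] [CharP K p]
    (h : adjoin E (Set.range fun x : K => x ^ p) = ⊤) : Algebra.IsSeparable E K := by
  have hp : ExpChar K p := .prime Fact.out
  have step : ∀ n : ℕ, adjoin E (Set.range fun x : K => x ^ p ^ n) = ⊤ := by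
    intro n
    induction n with
    | zero =>
      rw [eq_top_iff]
      exact fun x _ => subset_adjoin _ _ ⟨x, by simp⟩
    | succ n ih =>
      rw [eq_top_iff, ← h, adjoin_le_iff]
      rintro _ ⟨x, rfl⟩
      set M := adjoin E (Set.range fun x : K => x ^ p ^ (n + 1)) with hM
      -- Frobenius sends generators over `E` at level `n` into the field of level `n + 1`. By
      -- induction level `n` is all of `K`, so every `x ^ p` lies in level `n + 1`.
      have hle : (adjoin E (Set.range fun x : K => x ^ p ^ n)).toSubfield ≤
          M.toSubfield.comap (frobenius K p) := by
        rw [adjoin_toSubfield, Subfield.closure_le, Set.union_subset_iff]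
        constructor
        · rintro _ ⟨a, rfl⟩
          exact pow_mem (M.algebraMap_mem a) p
        · rintro _ ⟨y, rfl⟩
          refine subset_adjoin _ _ ⟨y, ?_⟩
          simp only [frobenius_def]
          rw [← pow_mul, pow_succ]
      exact hle (show x ∈ adjoin E _ by rw [ih]; trivial)
  have : CharP E p := (RingHom.charP_iff _ (algebraMap E K).injective p).2 inferInstance
  have : ExpChar E p := .prime Fact.out
  have : ExpChar (separableClosure E K) p :=
    expChar_of_injective_algebraMap (algebraMap E (separableClosure E K)).injective p
  -- `K` is purely inseparable of bounded exponent over the separable closure of `E`, so for some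
  -- `n` all `p ^ n`-th powers are separable, and these generate `K`.
  obtain ⟨n, hn⟩ := (IsPurelyInseparable.hasExponent_iff' (separableClosure E K) (L := K) p).1
    inferInstance
  rw [← separableClosure.eq_top_iff, eq_top_iff, ← step n, adjoin_le_iff]
  rintro _ ⟨x, rfl⟩
  obtain ⟨y, hy⟩ := hn x
  change x ^ p ^ n ∈ _
  rw [← hy]
  exact y.2

variable {k K : Type*} [Field k] [Field K] [Algebra k K]

theorem finrank_adjoin_le_of_pow_eq {F : Type*} [Field F] [Algebra F K] {z : K} {p : ℕ}
    (hp : p ≠ 0) {a : F} (h : algebraMap F K a = z ^ p) :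
    FiniteDimensional F F⟮z⟯ ∧ Module.finrank F F⟮z⟯ ≤ p := by
  have hmonic : (Polynomial.X ^ p - Polynomial.C a).Monic := Polynomial.monic_X_pow_sub_C a hp
  have hroot : Polynomial.aeval z (Polynomial.X ^ p - Polynomial.C a) = 0 := by simp [h]
  have hint : IsIntegral F z := ⟨_, hmonic, hroot⟩
  refine ⟨IntermediateField.adjoin.finiteDimensional hint, ?_⟩
  rw [IntermediateField.adjoin.finrank hint]
  refine (Polynomial.natDegree_le_of_dvd (minpoly.dvd F z hroot) hmonic.ne_zero).trans ?_
  rw [Polynomial.natDegree_X_pow_sub_C]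

theorem finrank_adjoin_eq_of_pow_eq {F : Type*} [Field F] [Algebra F K] {z : K} {p : ℕ}
    (hp : p.Prime) {a : F} (h : algebraMap F K a = z ^ p) (ha : ∀ b : F, b ^ p ≠ a) :
    Module.finrank F F⟮z⟯ = p := by
  have hmonic : (Polynomial.X ^ p - Polynomial.C a).Monic :=
    Polynomial.monic_X_pow_sub_C a hp.ne_zero
  have hroot : Polynomial.aeval z (Polynomial.X ^ p - Polynomial.C a) = 0 := by simp [h]
  rw [IntermediateField.adjoin.finrank ⟨_, hmonic, hroot⟩,
    ← minpoly.eq_of_irreducible_of_monic (X_pow_sub_C_irreducible_of_prime hp ha) hroot hmonic,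
    Polynomial.natDegree_X_pow_sub_C]

/-- Clearing denominators in `w = r(w ^ n) / s(w ^ n)` and comparing degrees would give `1 + n * deg
s = n * deg r`. -/
theorem notMem_adjoin_pow {w : K} (hw : Transcendental k w) {n : ℕ} (hn : 1 < n) :
    w ∉ k⟮w ^ n⟯ := by
  intro h
  obtain ⟨r, s, hrs⟩ := (IntermediateField.mem_adjoin_simple_iff k w).1 h
  have hw0 : w ≠ 0 := by
    rintro rfl
    exact hw isAlgebraic_zero
  have hs : Polynomial.aeval (w ^ n) s ≠ 0 := by
    intro hs
    rw [hs, div_zero] at hrs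
    exact hw0 hrs
  rw [eq_div_iff hs, ← Polynomial.expand_aeval, ← Polynomial.expand_aeval] at hrs
  have hpoly : Polynomial.X * Polynomial.expand k n s = Polynomial.expand k n r := by
    refine transcendental_iff_injective.1 hw ?_
    simpa using hrs
  have hs0 : s ≠ 0 := by
    rintro rfl
    simp at hs
  have hdeg := congrArg Polynomial.natDegree hpoly
  rw [Polynomial.natDegree_X_mul (by
    simpa [Polynomial.expand_eq_zero (by lia : 0 < n)] using hs0), Polynomial.natDegree_expand,
    Polynomial.natDegree_expand] at hdeg
  have h1 : n ∣ s.natDegree * n + 1 := ⟨r.natDegree, by rw [hdeg, mul_comm]⟩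
  have h2 : n ∣ 1 := (Nat.dvd_add_right (Dvd.intro_left _ rfl)).1 h1
  exact absurd (Nat.le_of_dvd one_pos h2) (by lia)

/-- The degree of `K` over `K^p` for a function field of one variable over a perfect field. -/
theorem finrank_fieldRange_frobenius (p : ℕ) [Fact p.Prime] [CharP K p] [PerfectField k]
    (z : K) [FiniteDimensional k⟮z⟯ K] :
    FiniteDimensional (frobenius K p).fieldRange K ∧
      Module.finrank (frobenius K p).fieldRange K ≤ p := by
  set E : Subfield K := k⟮z⟯.toSubfield with hE
  set Ep : Subfield K := E.map (frobenius K p) with hEp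
  have hEpE : Ep ≤ E := by
    rintro _ ⟨x, hx, rfl⟩
    exact pow_mem (show x ∈ E from hx) p
  have hEpK : Ep ≤ (frobenius K p).fieldRange := by
    rintro _ ⟨x, hx, rfl⟩
    exact ⟨x, rfl⟩
  have hrange : (frobenius K p).fieldRange = (⊤ : Subfield K).map (frobenius K p) :=
    RingHom.fieldRange_eq_map _
  -- With `E = k(z)`, Frobenius gives `[K^p : E^p] = [K : E]`. Comparing the towers through `E` and
  -- through `K^p` yields `[K : K^p] = [E : E^p]`.
  have h1 : Ep.relfinrank (frobenius K p).fieldRange = E.relfinrank ⊤ := by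
    rw [hrange, hEp, Subfield.relfinrank_map_map]
  have h2 : 0 < E.relfinrank ⊤ := by
    rw [Subfield.relfinrank_top_right]
    exact (Module.finrank_pos : 0 < Module.finrank k⟮z⟯ K)
  have h3 := Subfield.relfinrank_mul_relfinrank hEpE (le_top : E ≤ ⊤)
  rw [← Subfield.relfinrank_mul_relfinrank hEpK le_top, h1, mul_comm] at h3
  have h4 := Nat.eq_of_mul_eq_mul_left h2 h3
  rw [Subfield.relfinrank_top_right, Subfield.relfinrank_eq_finrank_of_le hEpE] at h4
  -- Perfectness of `k` puts the constants in `E^p`, so `E = E^p(z)`, of degree at most `p`.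
  have hEadj : Subfield.extendScalars hEpE = IntermediateField.adjoin Ep {z} := by
    apply le_antisymm
    · intro x hx
      have hle : E ≤ (IntermediateField.adjoin Ep {z}).toSubfield := by
        rw [hE, IntermediateField.adjoin_toSubfield, Subfield.closure_le, Set.union_subset_iff]
        constructor
        · rintro _ ⟨a, rfl⟩
          have : CharP k p := (RingHom.charP_iff _ (algebraMap k K).injective p).2 inferInstance
          have : ExpChar k p := .prime Fact.out
          obtain ⟨b, rfl⟩ := (PerfectField.toPerfectRing p : PerfectRing k p).bijective_frobenius.2 a
          have hb : algebraMap k K (frobenius k p b) ∈ Ep :=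
            ⟨algebraMap k K b, k⟮z⟯.algebraMap_mem b, by simp [frobenius_def]⟩
          exact (IntermediateField.adjoin Ep {z}).algebraMap_mem ⟨_, hb⟩
        · exact IntermediateField.subset_adjoin _ _
      exact hle hx
    · rw [IntermediateField.adjoin_le_iff, Set.singleton_subset_iff]
      exact IntermediateField.mem_adjoin_simple_self k z
  rw [hEadj] at h4
  obtain ⟨hfin, hle⟩ := finrank_adjoin_le_of_pow_eq (F := Ep) (z := z)
    (Fact.out : p.Prime).ne_zero
    (a := ⟨z ^ p, z, IntermediateField.mem_adjoin_simple_self k z, rfl⟩) rfl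
  refine ⟨FiniteDimensional.of_finrank_pos ?_, ?_⟩
  · rw [← h4]
    exact Module.finrank_pos
  · rw [← h4]
    exact hle

/-- If `K` is not separable over `k(z)`, then `z` is a `p`-th power. -/
theorem exists_pow_eq_of_not_isSeparable (p : ℕ) [Fact p.Prime] [CharP K p] [PerfectField k]
    (z : K) [FiniteDimensional k⟮z⟯ K]
    (h : ¬ Algebra.IsSeparable k⟮z⟯ K) : ∃ w : K, w ^ p = z := by
  by_contra! hz
  obtain ⟨hfin, hle⟩ := finrank_fieldRange_frobenius (k := k) p z
  -- If `z` is not a `p`-th power, `X ^ p - z ^ p` is irreducible over `K^p`. Then `K^p(z)` has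
  -- degree `p` and must be all of `K`.
  have hdeg : Module.finrank (frobenius K p).fieldRange
      (IntermediateField.adjoin (frobenius K p).fieldRange {z}) = p := by
    refine finrank_adjoin_eq_of_pow_eq Fact.out (a := ⟨z ^ p, z, rfl⟩) rfl ?_
    rintro ⟨_, b, rfl⟩ hb
    have hb' : (frobenius K p b) ^ p = z ^ p := congrArg Subtype.val hb
    exact hz b (frobenius_inj K p hb')
  have htop : IntermediateField.adjoin (frobenius K p).fieldRange {z} = ⊤ :=
    IntermediateField.eq_of_le_of_finrank_le le_top (by
      rw [IntermediateField.finrank_top', hdeg]; exact hle)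
  refine h (isSeparable_of_adjoin_pow_eq_top p ?_)
  rw [eq_top_iff]
  intro x _
  have hx : x ∈ (IntermediateField.adjoin (frobenius K p).fieldRange {z}).toSubfield := by
    rw [htop]; trivial
  rw [IntermediateField.adjoin_toSubfield] at hx
  refine (Subfield.closure_le (t := (IntermediateField.adjoin k⟮z⟯
    (Set.range fun x : K => x ^ p)).toSubfield)).2 ?_ hx
  rw [Set.union_subset_iff]
  constructor
  · rintro _ ⟨⟨_, y, rfl⟩, rfl⟩
    exact IntermediateField.subset_adjoin _ _ ⟨y, rfl⟩
  · rw [Set.singleton_subset_iff]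
    exact (IntermediateField.adjoin k⟮z⟯ (Set.range fun x : K => x ^ p)).algebraMap_mem
      ⟨z, IntermediateField.mem_adjoin_simple_self k z⟩

/-- Every transcendental element of a function field is a `p`-power of an element `x` such that
`K` is separable over `k(x)`. -/
theorem exists_pow_eq_and_isSeparable (p : ℕ) [Fact p.Prime] [CharP K p] [PerfectField k]
    (hfin : ∀ z : K, Transcendental k z → FiniteDimensional k⟮z⟯ K)
    (z : K) (hz : Transcendental k z) :
    ∃ (x : K) (n : ℕ), 0 < n ∧ x ^ n = z ∧ Transcendental k x ∧ Algebra.IsSeparable k⟮x⟯ K := by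
  induction hd : Module.finrank k⟮z⟯ K using Nat.strong_induction_on generalizing z with
  | h d ih =>
    have := hfin z hz
    by_cases hsep : Algebra.IsSeparable k⟮z⟯ K
    · exact ⟨z, 1, one_pos, pow_one z, hz, hsep⟩
    obtain ⟨w, rfl⟩ := exists_pow_eq_of_not_isSeparable (k := k) p z hsep
    have hp : p.Prime := Fact.out
    have hw : Transcendental k w := fun hw => hz (hw.pow p)
    have := hfin w hw
    have hlt : Module.finrank k⟮w⟯ K < d := by
      have hle : k⟮w ^ p⟯ ≤ k⟮w⟯ := by
        rw [IntermediateField.adjoin_simple_le_iff]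
        exact pow_mem (IntermediateField.mem_adjoin_simple_self k w) p
      have hmul := Subfield.relfinrank_mul_finrank_top
        (A := k⟮w ^ p⟯.toSubfield) (B := k⟮w⟯.toSubfield) hle
      change _ * Module.finrank k⟮w⟯ K = Module.finrank k⟮w ^ p⟯ K at hmul
      have hne : Subfield.relfinrank k⟮w ^ p⟯.toSubfield k⟮w⟯.toSubfield ≠ 1 := by
        rw [Ne, Subfield.relfinrank_eq_one_iff]
        exact fun h => notMem_adjoin_pow hw hp.one_lt
          (h (IntermediateField.mem_adjoin_simple_self k w))
      have hpos : 0 < Module.finrank k⟮w ^ p⟯ K := Module.finrank_pos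
      have hpos' : 0 < Module.finrank k⟮w⟯ K := Module.finrank_pos
      rw [hd] at hmul hpos
      rw [← hmul] at hpos ⊢
      have := Nat.pos_of_mul_pos_right hpos
      nlinarith [Nat.pos_of_ne_zero (left_ne_zero_of_mul hpos.ne'), Nat.lt_of_le_of_ne
        (Nat.pos_of_ne_zero (left_ne_zero_of_mul hpos.ne')) hne.symm]
    obtain ⟨x, n, hn, hx, hxt, hxs⟩ := ih _ hlt w hw rfl
    exact ⟨x, n * p, Nat.mul_pos hn hp.pos, by rw [pow_mul, hx], hxt, hxs⟩

end Separability

/-! ### `K` as an extension of the rational function field. -/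

section RationalFunctionStructure

open Polynomial

variable {k K : Type*} [Field k] [Field K] [Algebra k K]

/-- A transcendental element `t` makes `K` an algebra over `k[X]` and `k(X)`, with `X ↦ t`. -/
theorem exists_ratFunc_algebra (t : K) (ht : Transcendental k t) :
    ∃ (_ : Algebra k[X] K) (_ : Algebra (RatFunc k) K),
      IsScalarTower k k[X] K ∧ IsScalarTower k[X] (RatFunc k) K ∧ IsScalarTower k (RatFunc k) K ∧
      (∀ f : k[X], algebraMap k[X] K f = aeval t f) ∧
      (FiniteDimensional k⟮t⟯ K → FiniteDimensional (RatFunc k) K) ∧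
      (Algebra.IsSeparable k⟮t⟯ K → Algebra.IsSeparable (RatFunc k) K) ∧
      Module.finrank (RatFunc k) K = Module.finrank k⟮t⟯ K := by
  let e := RatFunc.algEquivOfTranscendental t ht
  let i1 : Algebra k[X] K := (aeval t).toRingHom.toAlgebra
  let i2 : Algebra (RatFunc k) K := (k⟮t⟯.val.comp e.toAlgHom).toRingHom.toAlgebra
  have hcomp : (algebraMap (RatFunc k) K).comp (e.symm.toRingEquiv : k⟮t⟯ →+* RatFunc k) =
      ((RingEquiv.refl K : K ≃+* K) : K →+* K).comp (algebraMap k⟮t⟯ K) := by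
    ext x
    change ((e (e.symm x) : k⟮t⟯) : K) = x
    rw [e.apply_symm_apply]
  refine ⟨i1, i2, .of_algebraMap_eq fun x => ?_, .of_algebraMap_eq fun x => ?_,
    .of_algebraMap_eq fun x => ?_, fun f => rfl, fun h => ?_, fun h => ?_, ?_⟩
  · exact ((aeval t).commutes x).symm
  · change aeval t x = ((e (algebraMap k[X] (RatFunc k) x) : k⟮t⟯) : K)
    rw [RatFunc.algEquivOfTranscendental_algebraMap]
    simp [Polynomial.aeval_def, Polynomial.eval₂_eq_sum_range]
  · exact ((k⟮t⟯.val.comp e.toAlgHom).commutes x).symm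
  · exact Module.Finite.of_equiv_equiv e.symm.toRingEquiv (RingEquiv.refl K) hcomp
  · exact Algebra.IsSeparable.of_equiv_equiv e.symm.toRingEquiv (RingEquiv.refl K) hcomp
  · exact (Algebra.finrank_eq_of_equiv_equiv e.symm.toRingEquiv (RingEquiv.refl K) hcomp).symm

end RationalFunctionStructure

section FunctionField

variable {k K : Type*} [Field k] [Field K] [Algebra k K]

theorem IsFunctionField.finiteDimensional_adjoin (hK : IsFunctionField k K) (z : K)
    (hz : Transcendental k z) : FiniteDimensional k⟮z⟯ K := by
  obtain ⟨t, ht, hfin⟩ := hK.exists_finite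
  obtain ⟨_, _, _, _, _, -, h, -⟩ := exists_ratFunc_algebra t ht
  have := h hfin
  exact FunctionField.finiteDimensional_of_adjoin_transcendental hz

end FunctionField

end DrinfeldModular

namespace DrinfeldModular

open scoped IntermediateField

/-! ### Integral closures as intersections of valuation rings. -/

section IntegralClosure

open Polynomial

variable {k K : Type*} [Field k] [Field K] [Algebra k K]

theorem aeval_mem_of_mem {t : K} {C : Subring K} (hk : ∀ a : k, algebraMap k K a ∈ C)
    (ht : t ∈ C) (f : k[X]) : aeval t f ∈ C := by
  rw [aeval_eq_sum_range]
  refine sum_mem fun i _ => ?_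
  rw [Algebra.smul_def]
  exact mul_mem (hk _) (pow_mem ht i)

/-- Valuation rings are integrally closed, and an integrally closed subring of a field is the
intersection of the valuation rings above it. -/
theorem isIntegral_iff_forall_valuationSubring {R : Type*} [CommRing R] [Algebra R K] (z : K) :
    IsIntegral R z ↔ ∀ v : ValuationSubring K, (∀ r : R, algebraMap R K r ∈ v) → z ∈ v := by
  constructor
  · intro hz v hv
    let i : Algebra R v := ((algebraMap R K).codRestrict v hv).toAlgebra
    have : IsScalarTower R v K := .of_algebraMap_eq fun f => rfl
    obtain ⟨y, rfl⟩ := IsIntegrallyClosed.isIntegral_iff.1 (hz.tower_top (A := v))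
    exact y.2
  · intro h
    by_contra hz
    let S : Subring K := (integralClosure R K).toSubring
    have : IsIntegrallyClosedIn S K :=
      inferInstanceAs (IsIntegrallyClosedIn (integralClosure R K) K)
    obtain ⟨v, hv, hzv⟩ := Subring.exists_le_valuationSubring_of_isIntegrallyClosedIn
      (R := S) (x := z) hz
    exact hzv (h v fun r => hv ((integralClosure R K).algebraMap_mem r))

/-- The integral closure of `k[t]` is the intersection of the valuation rings containing it. -/
theorem isIntegral_polynomial_iff [Algebra k[X] K] {t : K}
    (hX : ∀ f : k[X], algebraMap k[X] K f = aeval t f) (z : K) :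
    IsIntegral k[X] z ↔
      ∀ v : ValuationSubring K, (∀ a : k, algebraMap k K a ∈ v) → t ∈ v → z ∈ v := by
  rw [isIntegral_iff_forall_valuationSubring]
  refine forall_congr' fun v => ⟨fun h hk ht => h fun f => ?_, fun h hv => h (fun a => ?_) ?_⟩
  · rw [hX]
    exact aeval_mem_of_mem (C := v.toSubring) hk ht f
  · simpa [hX] using hv (C a)
  · simpa [hX] using hv X

/-- The integral closure of `k[t]` in a finite separable extension of `k(t)` is a Dedekind domain
with finite class group. -/
theorem isDedekindDomain_and_finite_classGroup [Finite k] {t : K} (ht : Transcendental k t)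
    [FiniteDimensional k⟮t⟯ K] [Algebra.IsSeparable k⟮t⟯ K] (B : Subring K)
    (hB : ∀ z, z ∈ B ↔
      ∀ v : ValuationSubring K, (∀ a : k, algebraMap k K a ∈ v) → t ∈ v → z ∈ v) :
    IsFractionRing B K ∧ IsDedekindDomain B ∧ Finite (ClassGroup B) := by
  obtain ⟨_, _, _, _, _, hX, hfin, hsep, -⟩ := exists_ratFunc_algebra t ht
  have := hfin inferInstance
  have := hsep inferInstance
  have hB' (z : K) : z ∈ B ↔ IsIntegral k[X] z := by
    rw [hB, isIntegral_polynomial_iff hX]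
  let i : Algebra k[X] B := ((algebraMap k[X] K).codRestrict B fun f =>
    (hB' _).2 isIntegral_algebraMap).toAlgebra
  have : IsScalarTower k[X] B K := .of_algebraMap_eq fun f => rfl
  have : IsIntegralClosure B k[X] K :=
    ⟨Subtype.val_injective, fun {z} => by
      rw [← hB']
      exact ⟨fun h => ⟨⟨z, h⟩, rfl⟩, by rintro ⟨y, rfl⟩; exact y.2⟩⟩
  have h1 := IsIntegralClosure.isDedekindDomain k[X] (RatFunc k) K B
  have := Fintype.ofFinite k
  classical
  exact ⟨IsIntegralClosure.isFractionRing_of_finite_extension k[X] (RatFunc k) K B, h1,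
    @Finite.of_fintype _ (ClassGroup.fintypeOfAdmissibleOfFinite (RatFunc k) K
      (Polynomial.cardPowDegreeIsAdmissible :
        AbsoluteValue.IsAdmissible (Polynomial.cardPowDegree : AbsoluteValue k[X] ℤ)))⟩

end IntegralClosure

end DrinfeldModular

namespace DrinfeldModular

open scoped IntermediateField nonZeroDivisors

/-! ### Valuation rings over a Dedekind domain and their centers. -/

section ValuationRings

variable {K : Type*} [Field K]

theorem notMem_iff_one_lt_valuation (v : ValuationSubring K) (x : K) :
    x ∉ v ↔ v.valuation x⁻¹ < 1 ∧ x ≠ 0 := by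
  rw [← v.valuation_le_one_iff, not_le, map_inv₀]
  constructor
  · intro h
    refine ⟨inv_lt_one_of_one_lt₀ h, ?_⟩
    rintro rfl
    simp at h
  · rintro ⟨h, hx⟩
    exact (inv_lt_one₀ (zero_lt_iff.2 ((v.valuation.ne_zero_iff).2 hx))).1 h

/-- The ideal of elements of `B` that are not units of the valuation ring `v ⊇ B`. -/
def center (B : Subring K) (v : ValuationSubring K) (h : B ≤ v.toSubring) : Ideal B :=
  (IsLocalRing.maximalIdeal v).comap (Subring.inclusion h)

theorem mem_center {B : Subring K} {v : ValuationSubring K} {h : B ≤ v.toSubring} {b : B} :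
    b ∈ center B v h ↔ v.valuation b < 1 := by
  exact ValuationSubring.valuation_lt_one_iff v (Subring.inclusion h b)

instance (B : Subring K) (v : ValuationSubring K) (h : B ≤ v.toSubring) :
    (center B v h).IsPrime := Ideal.comap_isPrime _ _

/-- A nontrivial valuation ring containing a Dedekind domain `B` with fraction field `K` is
determined by its center on `B`. -/
theorem eq_valuationSubring_of_center {B : Subring K} [IsFractionRing B K] [IsDedekindDomain B]
    (w : IsDedekindDomain.HeightOneSpectrum B) (v : ValuationSubring K) (hv : v ≠ ⊤)
    (h : B ≤ v.toSubring) (hw : center B v h = w.asIdeal) :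
    v = (w.valuation K).valuationSubring := by
  have hle : ∀ z, w.valuation K z ≤ 1 → z ∈ v := by
    intro z hz
    obtain ⟨a, b, hab⟩ := w.exists_primeCompl_mul_eq_of_integer z hz
    have hb : v.valuation (b : B) = 1 := by
      refine le_antisymm ((v.valuation_le_one_iff _).2 (h (b : B).2)) (not_lt.1 fun hlt => ?_)
      have hbc : (b : B) ∈ center B v h := mem_center.2 hlt
      rw [hw] at hbc
      exact b.2 hbc
    have hzb : v.valuation z = v.valuation (z * (b : B)) := by rw [map_mul, hb, mul_one]
    rw [← v.valuation_le_one_iff, hzb, v.valuation_le_one_iff]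
    change z * algebraMap B K b ∈ v
    rw [hab]
    exact h a.2
  ext z
  refine ⟨fun hz => ?_, hle z⟩
  by_contra hz1
  rw [Valuation.mem_valuationSubring_iff, not_le] at hz1
  -- The value group of `w` is archimedean, so the powers of an element outside the ring of `w`,
  -- together with that ring, exhaust `K`.
  refine hv (eq_top_iff.2 fun u _ => ?_)
  obtain ⟨n, hn⟩ := MulArchimedean.arch (w.valuation K u) hz1
  have hz0 : z ≠ 0 := by
    rintro rfl
    simp at hz1
  have : u = u / z ^ n * z ^ n := by
    rw [div_mul_cancel₀ _ (pow_ne_zero n hz0)]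
  rw [this]
  refine mul_mem (hle _ ?_) (pow_mem hz n)
  rw [map_div₀, map_pow]
  exact div_le_one_of_le₀ hn zero_le

end ValuationRings

/-! ### Separating one pole from the others. -/

section Poles

variable {k K : Type*} [Field k] [Field K] [Algebra k K]

theorem transcendental_of_notMem {P : ValuationSubring K} (hP : IsPlace k P) {x : K}
    (hx : x ∉ P) : Transcendental k x := by
  intro h
  refine hx ((isIntegral_iff_forall_valuationSubring (R := k) x).1 h.isIntegral P
    hP.algebraMap_mem)

theorem exists_place_notMem {f : K} (hf : Transcendental k f) :
    ∃ v : ValuationSubring K, IsPlace k v ∧ f ∉ v := by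
  by_contra! h
  refine hf (IsIntegral.isAlgebraic ((isIntegral_iff_forall_valuationSubring f).2 fun v hv => ?_))
  by_cases hv' : v = ⊤
  · rw [hv']; trivial
  · exact h v ⟨hv, hv'⟩

theorem transcendental_inv {x : K} (hx : Transcendental k x) : Transcendental k x⁻¹ :=
  fun h => hx (by simpa using h.inv)

theorem adjoin_inv (x : K) : k⟮x⁻¹⟯ = k⟮x⟯ := by
  apply le_antisymm <;> rw [IntermediateField.adjoin_simple_le_iff]
  · exact inv_mem (IntermediateField.mem_adjoin_simple_self k x)
  · rw [← inv_mem_iff]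
    exact IntermediateField.mem_adjoin_simple_self k x⁻¹

/-- If `x` has a pole at `P`, some function has a pole at `P` and at no other pole of `x`. -/
theorem exists_notMem_and_forall_mem [Finite k] {P : ValuationSubring K} (hP : IsPlace k P)
    {x : K} (hx : x ∉ P) [FiniteDimensional k⟮x⟯ K] [Algebra.IsSeparable k⟮x⟯ K] :
    ∃ z : K, z ∉ P ∧ ∀ v : ValuationSubring K, IsPlace k v → v ≠ P → x ∉ v → z ∈ v := by
  obtain ⟨hy1, hx0⟩ := (notMem_iff_one_lt_valuation P x).1 hx
  have hxt := transcendental_of_notMem hP hx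
  have hyt := transcendental_inv hxt
  have : FiniteDimensional k⟮x⁻¹⟯ K := by rw [adjoin_inv]; infer_instance
  have : Algebra.IsSeparable k⟮x⁻¹⟯ K := by rw [adjoin_inv]; infer_instance
  -- `B` is the integral closure of `k[x⁻¹]`; every pole of `x` has a nonzero center on it, as `x⁻¹`
  -- lies in that center.
  let B : Subring K := ⨅ v : {v : ValuationSubring K // (∀ a : k, algebraMap k K a ∈ v) ∧ x⁻¹ ∈ v},
    v.1.toSubring
  have hB (z : K) : z ∈ B ↔
      ∀ v : ValuationSubring K, (∀ a : k, algebraMap k K a ∈ v) → x⁻¹ ∈ v → z ∈ v := by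
    simp [B, Subring.mem_iInf]
  obtain ⟨_, _, _⟩ := isDedekindDomain_and_finite_classGroup hyt B hB
  have hBv {v : ValuationSubring K} (hv : IsPlace k v) (hxv : x ∉ v) : B ≤ v.toSubring :=
    fun z hz => (hB z).1 hz v hv.algebraMap_mem
      ((v.valuation_le_one_iff _).1 ((notMem_iff_one_lt_valuation v x).1 hxv).1.le)
  have hyB : x⁻¹ ∈ B := (hB _).2 fun v _ h => h
  have hbot {v : ValuationSubring K} (hv : IsPlace k v) (hxv : x ∉ v) :
      center B v (hBv hv hxv) ≠ ⊥ := by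
    intro h
    have : (⟨x⁻¹, hyB⟩ : B) ∈ center B v (hBv hv hxv) :=
      mem_center.2 ((notMem_iff_one_lt_valuation v x).1 hxv).1
    rw [h, Ideal.mem_bot] at this
    exact inv_ne_zero hx0 (congrArg Subtype.val this)
  set p := center B P (hBv hP hx) with hp
  -- Take `n` to be the class number of `B`. The inverse of a generator `e` of `p ^ n` is the
  -- desired function: a pole of it at `v` puts `e`, hence `p`, in the center of `v`.
  obtain ⟨n, hn, hpn⟩ : ∃ n ≠ 0, (p ^ n).IsPrincipal := by
    refine ⟨Nat.card (ClassGroup B), Nat.card_pos.ne', ?_⟩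
    have hp0 : p ∈ (Ideal B)⁰ := mem_nonZeroDivisors_of_ne_zero (hbot hP hx)
    rw [← ClassGroup.mk0_eq_one_iff (pow_mem hp0 _)]
    have := pow_card_eq_one' (x := ClassGroup.mk0 ⟨p, hp0⟩)
    rw [← map_pow] at this
    exact this
  obtain ⟨e, he⟩ := hpn
  have hep : e ∈ p := Ideal.pow_le_self hn (by rw [he]; exact Submodule.mem_span_singleton_self e)
  refine ⟨(e : K)⁻¹, ?_, fun v hv hvP hxv => ?_⟩
  · rw [notMem_iff_one_lt_valuation, inv_inv]
    refine ⟨mem_center.1 hep, inv_ne_zero fun h0 => ?_⟩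
    have he0 : e = 0 := Subtype.ext h0
    rw [he0] at he
    exact pow_ne_zero n (hbot hP hx) (by rw [← hp, he]; simp)
  · by_contra hev
    rw [notMem_iff_one_lt_valuation, inv_inv] at hev
    have heq : e ∈ center B v (hBv hv hxv) := mem_center.2 hev.1
    have hle : p ≤ center B v (hBv hv hxv) := by
      refine Ideal.IsPrime.le_of_pow_le (n := n) ?_
      rw [he]
      exact (Ideal.span_singleton_le_iff_mem _).2 heq
    have hpmax : p.IsMaximal := Ideal.IsPrime.isMaximal inferInstance (hbot hP hx)
    have hpv : p = center B v (hBv hv hxv) := hpmax.eq_of_le (Ideal.IsPrime.ne_top inferInstance) hle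
    let w : IsDedekindDomain.HeightOneSpectrum B := ⟨p, inferInstance, hbot hP hx⟩
    exact hvP ((eq_valuationSubring_of_center w v hv.ne_top _ hpv.symm).trans
      (eq_valuationSubring_of_center w P hP.ne_top _ rfl).symm)

end Poles

end DrinfeldModular

namespace DrinfeldModular

open scoped IntermediateField
open Polynomial

/-! ### Linear independence modulo `yW` and bounded values. -/

section IndependenceModulo

variable {k K : Type*} [Field k] [Field K] [Algebra k K]

/-- A polynomial in an element of the maximal ideal, with nonzero constant term, is a unit. -/
theorem valuation_aeval_eq_one {v : ValuationSubring K} (hk : ∀ a : k, algebraMap k K a ∈ v)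
    {y : K} (hy : v.valuation y < 1) {c : k[X]} (hc : c.coeff 0 ≠ 0) :
    v.valuation (aeval y c) = 1 := by
  have hc0 : v.valuation (algebraMap k K (c.coeff 0)) = 1 := by
    refine le_antisymm ((v.valuation_le_one_iff _).2 (hk _)) ?_
    have := (v.valuation_le_one_iff _).2 (hk (c.coeff 0)⁻¹)
    rw [map_inv₀, map_inv₀] at this
    refine (inv_le_one₀ (zero_lt_iff.2 ((v.valuation.ne_zero_iff).2 ?_))).1 this
    simpa using hc
  have hdiv : v.valuation (aeval y c.divX * y) < 1 := by
    rw [map_mul]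
    refine mul_lt_one_of_nonneg_of_lt_one_right ?_ zero_le hy
    exact (v.valuation_le_one_iff _).2
      (aeval_mem_of_mem (C := v.toSubring) hk ((v.valuation_le_one_iff y).1 hy.le) _)
  conv_lhs => rw [← divX_mul_X_add c]
  rw [map_add, map_mul, aeval_X, aeval_C, Valuation.map_add_eq_of_lt_right _ (by rwa [hc0]), hc0]

variable {W : Subring K} {y : K} {ι : Type*} [Fintype ι] {f : ι → K}

/-- If a family of elements of `W` is linearly independent over `k` modulo `yW`, a `k[y]`-linear
combination lies in `yW` only if the constant terms of its coefficients vanish. -/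
theorem coeff_zero_eq_zero_of_sum_mem (hkW : ∀ a : k, algebraMap k K a ∈ W) (hy : y ∈ W)
    (hy0 : y ≠ 0) (hf : ∀ i, f i ∈ W)
    (hind : ∀ c : ι → k, (∑ i, c i • f i) * y⁻¹ ∈ W → c = 0) (g : ι → k[X])
    (hg : (∑ i, aeval y (g i) * f i) * y⁻¹ ∈ W) (i : ι) : (g i).coeff 0 = 0 := by
  refine congrFun (hind (fun i => (g i).coeff 0) ?_) i
  have h : (∑ i, (g i).coeff 0 • f i) * y⁻¹ =
      (∑ i, aeval y (g i) * f i) * y⁻¹ - ∑ i, aeval y (g i).divX * f i := by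
    rw [Finset.sum_mul, Finset.sum_mul, ← Finset.sum_sub_distrib]
    refine Finset.sum_congr rfl fun i _ => ?_
    have hgi := congrArg (aeval y) (divX_mul_X_add (g i))
    simp only [map_add, map_mul, aeval_X, aeval_C] at hgi
    rw [← hgi, Algebra.smul_def]
    field_simp
    ring
  rw [h]
  exact sub_mem hg (sum_mem fun i _ => mul_mem (aeval_mem_of_mem hkW hy _) (hf i))

/-- A nontrivial `k[y]`-linear relation between `z ∈ W` and the `f i` can be chosen such that the
coefficient of `z` has nonzero constant term. -/
theorem exists_relation_coeff_zero_ne_zero (hkW : ∀ a : k, algebraMap k K a ∈ W) (hy : y ∈ W)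
    (hy0 : y ≠ 0) (hf : ∀ i, f i ∈ W)
    (hind : ∀ c : ι → k, (∑ i, c i • f i) * y⁻¹ ∈ W → c = 0) {z : K} (hz : z ∈ W)
    (c : k[X]) (g : ι → k[X]) (hcg : c ≠ 0 ∨ g ≠ 0)
    (h : aeval y c * z = ∑ i, aeval y (g i) * f i) :
    ∃ (c : k[X]) (g : ι → k[X]), c.coeff 0 ≠ 0 ∧
      aeval y c * z = ∑ i, aeval y (g i) * f i := by
  -- If `c` has zero constant term, then `c(y) z ∈ yW`, so independence kills all constant terms of
  -- the `g i` and the relation can be divided by `y`. Each division lowers the degree bound `m`, so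
  -- this stops.
  obtain ⟨m, hcm, hgm⟩ : ∃ m : ℕ, c.degree < m ∧ ∀ i, (g i).degree < m := by
    refine ⟨max c.natDegree (Finset.univ.sup fun i => (g i).natDegree) + 1, ?_, fun i => ?_⟩
    · refine lt_of_le_of_lt c.degree_le_natDegree (Nat.cast_lt.2 ?_)
      lia
    · refine lt_of_le_of_lt (g i).degree_le_natDegree (Nat.cast_lt.2 ?_)
      have := Finset.le_sup (f := fun i => (g i).natDegree) (Finset.mem_univ i)
      lia
  induction m generalizing c g with
  | zero =>
    exfalso
    have h0 {q : k[X]} (hq : q.degree < (0 : ℕ)) : q = 0 := by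
      simpa [Nat.WithBot.lt_zero_iff] using hq
    rcases hcg with hc | hg
    · exact hc (h0 hcm)
    · exact hg (funext fun i => h0 (hgm i))
  | succ m ih =>
    by_cases hc0 : c.coeff 0 = 0
    · have hdiv {q : k[X]} (hq : q.coeff 0 = 0) : q = q.divX * X := by
        conv_lhs => rw [← divX_mul_X_add q, hq, C_0, add_zero]
      have hc' := hdiv hc0
      have hg0 := coeff_zero_eq_zero_of_sum_mem hkW hy hy0 hf hind g (by
        rw [← h, hc', map_mul, aeval_X, mul_right_comm, mul_assoc _ y, mul_inv_cancel₀ hy0, mul_one]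
        exact mul_mem (aeval_mem_of_mem hkW hy _) hz)
      have hg' (i : ι) := hdiv (hg0 i)
      have hdeg {q : k[X]} (hq : q.coeff 0 = 0) (hqm : q.degree < (m + 1 : ℕ)) :
          q.divX.degree < m := by
        by_cases hq0 : q = 0
        · simp [hq0]
        · have hd : q.divX ≠ 0 := fun hd => hq0 (by rw [hdiv hq, hd, zero_mul])
          rw [degree_lt_iff_coeff_zero] at hqm ⊢
          intro j hj
          rw [coeff_divX]
          exact hqm _ (by lia)
      refine ih c.divX (fun i => (g i).divX) ?_ ?_ (hdeg hc0 hcm) fun i => hdeg (hg0 i) (hgm i)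
      · refine hcg.imp (fun hc hd => hc ?_) fun hg hd => hg (funext fun i => ?_)
        · rw [hc', hd, zero_mul]
        · rw [hg' i, show (g i).divX = 0 from congrFun hd i, zero_mul, Pi.zero_apply]
      · refine mul_right_cancel₀ hy0 ?_
        rw [Finset.sum_mul]
        calc aeval y c.divX * z * y = aeval y c * z := by
              conv_rhs => rw [hc', map_mul, aeval_X]
              ring
          _ = ∑ i, aeval y (g i) * f i := h
          _ = _ := Finset.sum_congr rfl fun i _ => by
              conv_lhs => rw [hg' i, map_mul, aeval_X]
              ring
    · exact ⟨c, g, hc0, h⟩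

theorem exists_polynomial_relation {y : K} (hyt : Transcendental k y) [FiniteDimensional k⟮y⟯ K]
    {n : ℕ} (hn : Module.finrank k⟮y⟯ K ≤ n) (f : Fin n → K) (z : K) :
    ∃ (c : k[X]) (g : Fin n → k[X]), (c ≠ 0 ∨ g ≠ 0) ∧
      aeval y c * z = ∑ i, aeval y (g i) * f i := by
  obtain ⟨_, _, _, _, _, hX, hfin, -, hrank⟩ := exists_ratFunc_algebra y hyt
  have := hfin inferInstance
  have hli : ¬ LinearIndependent k[X] (Fin.cons z f : Fin (n + 1) → K) := by
    rw [LinearIndependent.iff_fractionRing k[X] (RatFunc k)]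
    intro h
    have := h.fintype_card_le_finrank
    rw [Fintype.card_fin] at this
    lia
  obtain ⟨g, hg, i, hi⟩ := Fintype.not_linearIndependent_iff.1 hli
  refine ⟨g 0, fun j => -g j.succ, ?_, ?_⟩
  · by_contra! h
    refine hi (Fin.cases h.1 (fun j => ?_) i)
    exact neg_eq_zero.1 (congrFun h.2 j)
  · rw [Fin.sum_univ_succ] at hg
    simp only [Fin.cons_zero, Fin.cons_succ, Algebra.smul_def, hX] at hg
    simp only [map_neg, neg_mul, Finset.sum_neg_distrib]
    exact eq_neg_of_add_eq_zero_left hg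

/-- A ring `W` containing `[K : k(y)]` elements which are linearly independent over `k` modulo
`yW` is contained in every valuation ring with `y` in its maximal ideal. -/
theorem le_of_linearIndependent_modulo (hkW : ∀ a : k, algebraMap k K a ∈ W) (hy : y ∈ W)
    (hyt : Transcendental k y) [FiniteDimensional k⟮y⟯ K] {P : ValuationSubring K}
    (hkP : ∀ a : k, algebraMap k K a ∈ P) (hyP : P.valuation y < 1) {n : ℕ}
    (hn : Module.finrank k⟮y⟯ K ≤ n) {f : Fin n → K} (hf : ∀ i, f i ∈ W)
    (hind : ∀ c : Fin n → k, (∑ i, c i • f i) * y⁻¹ ∈ W → c = 0) : W ≤ P.toSubring := by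
  have hy0 : y ≠ 0 := by
    rintro rfl
    exact hyt isAlgebraic_zero
  have : Nonempty (Fin n) := ⟨⟨0, lt_of_lt_of_le Module.finrank_pos hn⟩⟩
  obtain ⟨j, hj⟩ := Finite.exists_max fun i => P.valuation (f i)
  have hle : ∀ z ∈ W, P.valuation z ≤ P.valuation (f j) := by
    intro z hz
    obtain ⟨c, g, hcg, h⟩ := exists_polynomial_relation hyt hn f z
    obtain ⟨c, g, hc, h⟩ := exists_relation_coeff_zero_ne_zero hkW hy hy0 hf hind hz c g hcg h
    have h' := congrArg P.valuation h
    rw [map_mul, valuation_aeval_eq_one hkP hyP hc, one_mul] at h'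
    rw [h']
    refine Valuation.map_sum_le _ fun i _ => ?_
    rw [map_mul]
    refine (mul_le_of_le_one_left' ?_).trans (hj i)
    exact (P.valuation_le_one_iff _).2
      (aeval_mem_of_mem (C := P.toSubring) hkP ((P.valuation_le_one_iff y).1 hyP.le) _)
  intro z hz
  refine (P.valuation_le_one_iff z).1 ((hle z hz).trans ?_)
  -- `W` is a ring, so the maximal value also bounds its own square and is therefore at most `1`.
  have hsq := hle _ (mul_mem (hf j) (hf j))
  rw [map_mul] at hsq
  by_cases h0 : P.valuation (f j) = 0
  · rw [h0]; exact zero_le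
  · exact (mul_le_iff_le_one_left (zero_lt_iff.2 h0)).1 hsq

end IndependenceModulo

end DrinfeldModular

namespace DrinfeldModular

open scoped IntermediateField
open Polynomial

/-! ### Dimension growth along the pole filtration. -/

section PoleFiltration

variable {k K : Type*} [Field k] [Field K] [Algebra k K]

/-- The elements `z` with `yᴺ z ∈ W`. -/
noncomputable def poleFiltration (W : Subalgebra k K) (y : K) (N : ℕ) : Submodule k K :=
  (Subalgebra.toSubmodule W).comap (LinearMap.mulLeft k (y ^ N))

theorem mem_poleFiltration {W : Subalgebra k K} {y z : K} {N : ℕ} :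
    z ∈ poleFiltration W y N ↔ y ^ N * z ∈ W := Iff.rfl

variable {W : Subalgebra k K} {y : K} {n : ℕ}

/-- Multiplication by `y ^ (N + 1)` embeds the quotient of `V` by its part in level `N` into `W /
yW`, and `hdep` says that `W / yW` has dimension less than `n`. -/
theorem finrank_succ_le_of_le_poleFiltration (hy0 : y ≠ 0)
    (hdep : ∀ f : Fin n → K, (∀ i, f i ∈ W) →
      ∃ c : Fin n → k, c ≠ 0 ∧ (∑ i, c i • f i) * y⁻¹ ∈ W)
    (N : ℕ) (V : Submodule k K) [FiniteDimensional k V] (hV : V ≤ poleFiltration W y (N + 1)) :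
    Module.finrank k V + 1 ≤
      Module.finrank k (V ⊓ poleFiltration W y N : Submodule k K) + n := by
  let U : Submodule k K := (Subalgebra.toSubmodule W).comap (LinearMap.mulLeft k y⁻¹)
  let φ : V →ₗ[k] K ⧸ U := U.mkQ ∘ₗ LinearMap.mulLeft k (y ^ (N + 1)) ∘ₗ V.subtype
  have hφ (v : V) : φ v = U.mkQ (y ^ (N + 1) * v) := rfl
  have hker : LinearMap.ker φ = (poleFiltration W y N).comap V.subtype := by
    ext v
    rw [LinearMap.mem_ker, hφ, Submodule.mkQ_apply, Submodule.Quotient.mk_eq_zero]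
    change y⁻¹ * (y ^ (N + 1) * v) ∈ W ↔ y ^ N * (v : K) ∈ W
    rw [pow_succ', mul_assoc, inv_mul_cancel_left₀ hy0]
  have hfr : Module.finrank k (LinearMap.ker φ) =
      Module.finrank k (V ⊓ poleFiltration W y N : Submodule k K) := by
    rw [hker, ← Submodule.map_comap_subtype, Submodule.finrank_map_subtype_eq]
  have hlt : Module.finrank k (LinearMap.range φ) < n := by
    by_contra! hle
    let b := Module.finBasis k (LinearMap.range φ)
    have hb (i : Fin n) : ∃ v : V, φ v = b (Fin.castLE hle i) := (b (Fin.castLE hle i)).2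
    choose v hv using hb
    obtain ⟨c, hc, hcW⟩ := hdep (fun i => y ^ (N + 1) * v i) fun i => hV (v i).2
    refine hc ?_
    have hli := b.linearIndependent.comp _ (Fin.castLE_injective hle)
    refine funext (Fintype.linearIndependent_iff.1 hli c ?_)
    apply Subtype.ext
    have h0 : φ (∑ i, c i • v i) = 0 := by
      rw [hφ, Submodule.mkQ_apply, Submodule.Quotient.mk_eq_zero]
      change y⁻¹ * _ ∈ W
      convert! hcW using 1
      rw [mul_comm]
      congr 1
      simp [Finset.mul_sum]
    rw [map_sum] at h0
    simpa [hv] using h0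
  have := LinearMap.finrank_range_add_finrank_ker φ
  lia

theorem finrank_add_le_of_le_poleFiltration (hy0 : y ≠ 0)
    (hdep : ∀ f : Fin n → K, (∀ i, f i ∈ W) →
      ∃ c : Fin n → k, c ≠ 0 ∧ (∑ i, c i • f i) * y⁻¹ ∈ W)
    (N : ℕ) (V : Submodule k K) [FiniteDimensional k V] (hV : V ≤ poleFiltration W y N) :
    Module.finrank k V + N ≤
      Module.finrank k (V ⊓ Subalgebra.toSubmodule W : Submodule k K) + N * n := by
  induction N generalizing V with
  | zero =>
    have hVW : V ≤ Subalgebra.toSubmodule W := fun z hz => by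
      simpa [mem_poleFiltration] using hV hz
    rw [inf_eq_left.2 hVW, zero_mul]
  | succ N ih =>
    have h1 := finrank_succ_le_of_le_poleFiltration hy0 hdep N V hV
    have : FiniteDimensional k (V ⊓ poleFiltration W y N : Submodule k K) :=
      Submodule.finiteDimensional_of_le inf_le_left
    have h2 := ih (V ⊓ poleFiltration W y N) inf_le_right
    have : FiniteDimensional k (V ⊓ Subalgebra.toSubmodule W : Submodule k K) :=
      Submodule.finiteDimensional_of_le inf_le_left
    have h3 : Module.finrank k
        (V ⊓ poleFiltration W y N ⊓ Subalgebra.toSubmodule W : Submodule k K) ≤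
        Module.finrank k (V ⊓ Subalgebra.toSubmodule W : Submodule k K) :=
      Submodule.finrank_mono (inf_le_inf_right _ inf_le_left)
    rw [Nat.succ_mul]
    lia

end PoleFiltration

/-! ### A nonconstant function with its only pole at `P`. -/

section Existence

variable {k K : Type*} [Field k] [Field K] [Algebra k K]

/-- The elements which are integral at all poles of `x` other than `P`. -/
def integralAtOtherPoles (P : ValuationSubring K) (x : K) : Subalgebra k K where
  carrier := {z | ∀ v : ValuationSubring K, IsPlace k v → v ≠ P → x ∉ v → z ∈ v}
  mul_mem' ha hb v h1 h2 h3 := mul_mem (ha v h1 h2 h3) (hb v h1 h2 h3)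
  add_mem' ha hb v h1 h2 h3 := add_mem (ha v h1 h2 h3) (hb v h1 h2 h3)
  algebraMap_mem' a _ h1 _ _ := h1.algebraMap_mem a

theorem mem_integralAtOtherPoles {P : ValuationSubring K} {x z : K} :
    z ∈ integralAtOtherPoles (k := k) P x ↔
      ∀ v : ValuationSubring K, IsPlace k v → v ≠ P → x ∉ v → z ∈ v := Iff.rfl

theorem inv_mem_of_notMem {v : ValuationSubring K} {x : K} (hx : x ∉ v) : x⁻¹ ∈ v :=
  (v.mem_or_inv_mem x).resolve_left hx

/-- Some `c(x⁻¹) b` with `c ≠ 0` is integral over `k[x⁻¹]`. At a pole of `x`, the part of `c` prime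
to `X` is a unit, so only a power of `x⁻¹` is needed. -/
theorem exists_pow_mul_mem_integralAtOtherPoles (P : ValuationSubring K) {x : K}
    (hx : Transcendental k x) [FiniteDimensional k⟮x⟯ K] (b : K) :
    ∃ N : ℕ, (x⁻¹) ^ N * b ∈ integralAtOtherPoles (k := k) P x := by
  have : FiniteDimensional k⟮x⁻¹⟯ K := by rw [adjoin_inv]; infer_instance
  obtain ⟨_, _, _, _, _, hX, hfin, -⟩ := exists_ratFunc_algebra x⁻¹ (transcendental_inv hx)
  have := hfin inferInstance
  have hb : IsAlgebraic k[X] b := (IsFractionRing.isAlgebraic_iff k[X] (RatFunc k) K).2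
    (Algebra.IsAlgebraic.isAlgebraic b)
  obtain ⟨c, hc0, hc⟩ := hb.exists_integral_multiple
  obtain ⟨d, hd, hdX⟩ := (FiniteMultiplicity.of_not_isUnit not_isUnit_X hc0).exists_eq_pow_mul_and_not_dvd
  refine ⟨multiplicity X c, fun v hv _ hxv => ?_⟩
  have h1 := (isIntegral_polynomial_iff hX _).1 hc v hv.algebraMap_mem (inv_mem_of_notMem hxv)
  rw [Algebra.smul_def, hX, hd, map_mul, map_pow, aeval_X] at h1
  have h2 := valuation_aeval_eq_one hv.algebraMap_mem
    ((notMem_iff_one_lt_valuation v x).1 hxv).1 (fun h => hdX (X_dvd_iff.2 h))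
  rw [← v.valuation_le_one_iff, map_mul, map_mul, h2, mul_one, ← map_mul,
    v.valuation_le_one_iff] at h1
  exact h1

/-- The functions `∑ gᵢ(x) bᵢ` with polynomials `gᵢ` of degree less than `m`. -/
noncomputable def boundedCombinations {ι : Type*} [Fintype ι] (x : K) (b : ι → K) (m : ℕ) :
    (ι → degreeLT k m) →ₗ[k] K :=
  ∑ i, LinearMap.mulRight k (b i) ∘ₗ (aeval x).toLinearMap ∘ₗ (degreeLT k m).subtype ∘ₗ
    LinearMap.proj i

theorem boundedCombinations_apply {ι : Type*} [Fintype ι] (x : K) (b : ι → K) (m : ℕ)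
    (g : ι → degreeLT k m) :
    boundedCombinations x b m g = ∑ i, aeval x (g i : k[X]) * b i := by
  simp [boundedCombinations]

theorem inv_pow_mul_aeval_mem {W : Subalgebra k K} {x : K} (hx0 : x ≠ 0) (hx : x⁻¹ ∈ W) {m : ℕ}
    {g : k[X]} (hg : g ∈ degreeLT k m) : (x⁻¹) ^ m * aeval x g ∈ W := by
  rw [aeval_eq_sum_range, Finset.mul_sum]
  refine sum_mem fun j _ => ?_
  by_cases hj : g.coeff j = 0
  · simp [hj]
  have hjm : j < m := by
    by_contra! h
    exact hj (coeff_eq_zero_of_degree_lt ((mem_degreeLT.1 hg).trans_le (by exact_mod_cast h)))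
  rw [mul_smul_comm]
  refine W.smul_mem ?_ _
  obtain ⟨l, rfl⟩ := Nat.exists_eq_add_of_le hjm.le
  rw [add_comm, pow_add, mul_assoc, ← mul_pow, inv_mul_cancel₀ hx0, one_pow, mul_one]
  exact pow_mem hx l

/-- A weak form of Riemann's theorem: for every place `P` there is a nonconstant function with no
pole outside `P`. -/
theorem exists_transcendental_mem_integralOutside_of_separable [Finite k] {P : ValuationSubring K}
    (hP : IsPlace k P) (hconst : ∀ x : K, IsAlgebraic k x → ∃ a : k, algebraMap k K a = x) {x : K}
    (hx : x ∉ P) [FiniteDimensional k⟮x⟯ K] [Algebra.IsSeparable k⟮x⟯ K] :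
    ∃ t ∈ integralOutside k P, Transcendental k t := by
  obtain ⟨hyP, hx0⟩ := (notMem_iff_one_lt_valuation P x).1 hx
  have hxt := transcendental_of_notMem hP hx
  set W : Subalgebra k K := integralAtOtherPoles P x with hW
  have hyW : x⁻¹ ∈ W := fun v _ _ hxv => inv_mem_of_notMem hxv
  -- `[K : k(x)]` independent elements modulo `x⁻¹ W` would force `W` into `P`, but `W` contains a
  -- function with a pole at `P`.
  have hdep : ∀ f : Fin (Module.finrank k⟮x⟯ K) → K, (∀ i, f i ∈ W) →
      ∃ c : Fin (Module.finrank k⟮x⟯ K) → k, c ≠ 0 ∧ (∑ i, c i • f i) * (x⁻¹)⁻¹ ∈ W := by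
    intro f hf
    by_contra! hind
    obtain ⟨z, hzP, hz⟩ := exists_notMem_and_forall_mem hP hx
    have : FiniteDimensional k⟮x⁻¹⟯ K := by rw [adjoin_inv]; infer_instance
    refine hzP (le_of_linearIndependent_modulo (W := W.toSubring) (y := x⁻¹) W.algebraMap_mem hyW
      (transcendental_inv hxt) hP.algebraMap_mem hyP (by rw [adjoin_inv]) hf (fun c hc => ?_) hz)
    by_contra hc0
    exact hind c hc0 hc
  obtain ⟨_, _, _, _, _, hX, hfin, -, hrank⟩ := exists_ratFunc_algebra x hxt
  have := hfin inferInstance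
  obtain ⟨s, b, hb⟩ := FiniteDimensional.exists_is_basis_integral k[X] (RatFunc k) K
  have hs : Fintype.card s = Module.finrank k⟮x⟯ K := by
    rw [← hrank, Module.finrank_eq_card_basis b]
  set n := Module.finrank k⟮x⟯ K with hn
  obtain ⟨J, hJ⟩ : ∃ J : ℕ, ∀ i, (x⁻¹) ^ J * b i ∈ W := by
    choose N hN using fun i => exists_pow_mul_mem_integralAtOtherPoles P hxt (b i)
    refine ⟨Finset.univ.sup N, fun i => ?_⟩
    obtain ⟨l, hl⟩ := Nat.exists_eq_add_of_le (Finset.le_sup (f := N) (Finset.mem_univ i))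
    rw [hl, add_comm, pow_add, mul_assoc]
    exact mul_mem (pow_mem hyW l) (hN i)
  -- The combinations span dimension `n * m` and lie in level `J + m`, so their intersection with
  -- `W` has dimension at least `n * m + (J + m) - (J + m) * n = J + m - J * n`. This choice of `m`
  -- makes it `J + 2`, more than the dimension of the constants.
  set m := J * n + 2 with hm
  let Φ := boundedCombinations (k := k) x b m
  have hΦ : Function.Injective Φ := by
    have hli := (LinearIndependent.iff_fractionRing k[X] (RatFunc k)).2 b.linearIndependent
    rw [← LinearMap.ker_eq_bot, LinearMap.ker_eq_bot']
    intro g hg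
    rw [boundedCombinations_apply] at hg
    refine funext fun i => Subtype.ext (Fintype.linearIndependent_iff.1 hli (fun i => g i) ?_ i)
    simpa only [Algebra.smul_def, hX] using hg
  have hV : LinearMap.range Φ ≤ poleFiltration W x⁻¹ (J + m) := by
    rintro _ ⟨g, rfl⟩
    rw [mem_poleFiltration, boundedCombinations_apply, Finset.mul_sum]
    refine sum_mem fun i _ => ?_
    have := mul_mem (hJ i) (inv_pow_mul_aeval_mem hx0 hyW (g i).2)
    convert! this using 1
    ring
  have hdim : Module.finrank k (LinearMap.range Φ) = n * m := by
    rw [LinearMap.finrank_range_of_inj hΦ, Module.finrank_pi_fintype]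
    simp [(degreeLTEquiv k m).finrank_eq, ← hs]
  have key := finrank_add_le_of_le_poleFiltration (inv_ne_zero hx0) hdep _ _ hV
  rw [hdim] at key
  obtain ⟨f, ⟨⟨g, rfl⟩, hfW⟩, hf1⟩ : ∃ f ∈ LinearMap.range Φ ⊓ Subalgebra.toSubmodule W,
      f ∉ Submodule.span k {(1 : K)} := by
    by_contra! hle
    have h1 := Submodule.finrank_mono (show _ ≤ _ from hle)
    have h2 := finrank_span_singleton (K := k) (one_ne_zero (α := K))
    rw [h2] at h1
    nlinarith
  refine ⟨Φ g, (mem_integralOutside k P _).2 fun v hv hvP => ?_, fun halg => hf1 ?_⟩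
  · by_cases hxv : x ∈ v
    · rw [boundedCombinations_apply]
      refine sum_mem fun i _ => mul_mem ?_ ?_
      · exact aeval_mem_of_mem (C := v.toSubring) hv.algebraMap_mem hxv _
      · exact (isIntegral_polynomial_iff hX (b i)).1 (hb i) v hv.algebraMap_mem hxv
    · exact hfW v hv hvP hxv
  · obtain ⟨a, ha⟩ := hconst _ halg
    exact Submodule.mem_span_singleton.2 ⟨a, by rw [← ha, Algebra.algebraMap_eq_smul_one]⟩

end Existence

end DrinfeldModular

namespace DrinfeldModular

open scoped IntermediateField

/-! ### `A` as the integral closure of a polynomial ring. -/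

section IntegralOutside

variable {k K : Type*} [Field k] [Field K] [Algebra k K]

theorem notMem_of_mem_integralOutside {P : ValuationSubring K} {t : K}
    (ht : t ∈ integralOutside k P) (htt : Transcendental k t) : t ∉ P := by
  obtain ⟨v, hv, htv⟩ := exists_place_notMem htt
  rcases eq_or_ne v P with rfl | hvP
  · exact htv
  · exact absurd ((mem_integralOutside k P t).1 ht v hv hvP) htv

/-- The only pole of `t` is `P`, so the valuation rings containing `k` and `t` are `K` and the
places other than `P`. This identifies `A` with the integral closure of `k[t]`. -/
theorem mem_integralOutside_iff_of_mem {P : ValuationSubring K} {t : K}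
    (ht : t ∈ integralOutside k P) (htt : Transcendental k t) (z : K) :
    z ∈ integralOutside k P ↔
      ∀ v : ValuationSubring K, (∀ a : k, algebraMap k K a ∈ v) → t ∈ v → z ∈ v := by
  rw [mem_integralOutside]
  constructor
  · intro hz v hk htv
    by_cases hv : v = ⊤
    · rw [hv]; trivial
    · refine hz v ⟨hk, hv⟩ ?_
      rintro rfl
      exact notMem_of_mem_integralOutside ht htt htv
  · intro hz v hv hvP
    exact hz v hv.algebraMap_mem ((mem_integralOutside k P t).1 ht v hv hvP)

theorem mem_of_pow_mem {v : ValuationSubring K} {x : K} {n : ℕ} (hn : 0 < n) (hx : x ^ n ∈ v) :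
    x ∈ v := by
  rw [← v.valuation_le_one_iff, map_pow] at hx
  exact (v.valuation_le_one_iff x).1 ((pow_le_one_iff hn.ne').1 hx)

/-- There is a nonconstant function `t` with no pole outside `P` such that `K` is finite and
separable over `k(t)`. -/
theorem exists_separating_mem_integralOutside [Finite k] (hK : IsFunctionField k K)
    {P : ValuationSubring K} (hP : IsPlace k P) (p : ℕ) [Fact p.Prime] [CharP K p] :
    ∃ t ∈ integralOutside k P, Transcendental k t ∧ FiniteDimensional k⟮t⟯ K ∧
      Algebra.IsSeparable k⟮t⟯ K := by
  obtain ⟨x₀, hx₀⟩ : ∃ x₀, x₀ ∉ P := by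
    by_contra! h
    exact hP.ne_top (eq_top_iff.2 fun x _ => h x)
  obtain ⟨x, n, hn, rfl, hxt, hxs⟩ := exists_pow_eq_and_isSeparable p hK.finiteDimensional_adjoin
    x₀ (transcendental_of_notMem hP hx₀)
  have hx : x ∉ P := fun h => hx₀ (pow_mem h n)
  have := hK.finiteDimensional_adjoin x hxt
  obtain ⟨t₀, ht₀, ht₀t⟩ :=
    exists_transcendental_mem_integralOutside_of_separable hP hK.constants hx
  -- `K` need not be separable over `k(t₀)`. Passing to a root `t` of `t₀` repairs this and
  -- introduces no new poles.
  obtain ⟨t, m, hm, rfl, htt, hts⟩ := exists_pow_eq_and_isSeparable p hK.finiteDimensional_adjoin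
    t₀ ht₀t
  refine ⟨t, (mem_integralOutside k P t).2 fun v hv hvP => ?_, htt,
    hK.finiteDimensional_adjoin t htt, hts⟩
  exact mem_of_pow_mem hm ((mem_integralOutside k P _).1 ht₀ v hv hvP)

end IntegralOutside

end DrinfeldModular

theorem mainTheorem3 {k K : Type*} [Field k] [Finite k] [Field K] [Algebra k K]
    (hK : DrinfeldModular.IsFunctionField k K)
    (P : ValuationSubring K) (hP : DrinfeldModular.IsPlace k P)
    (A : Subring K) (hA : A = DrinfeldModular.integralOutside k P) :
    Finite (DrinfeldModular.Cusp A) ∧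
    Nonempty (DrinfeldModular.Cusp A ≃ ClassGroup A) ∧
    Function.Injective (DrinfeldModular.pointStabilizer A) ∧
    Function.Injective (DrinfeldModular.cuspClass A) ∧
    ∃ τ : MulAut (GL (Fin 2) A) →* Equiv.Perm (ℙ K (Fin 2 → K)),
      (∀ (σ : MulAut (GL (Fin 2) A)) (s : ℙ K (Fin 2 → K)),
        (DrinfeldModular.pointStabilizer A s).map σ.toMonoidHom =
          DrinfeldModular.pointStabilizer A (τ σ s)) ∧
      ∃! Φ : MulAut (GL (Fin 2) A) →* Equiv.Perm (DrinfeldModular.Cusp A),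
        ∀ σ : MulAut (GL (Fin 2) A),
          (∀ c : DrinfeldModular.Cusp A,
            DrinfeldModular.mapClass σ (DrinfeldModular.cuspClass A c) =
              DrinfeldModular.cuspClass A (Φ σ c)) ∧
          (∀ s : ℙ K (Fin 2 → K),
            Φ σ (DrinfeldModular.toCusp A s) = DrinfeldModular.toCusp A (τ σ s)) := by
  subst hA
  obtain ⟨p, hp⟩ := CharP.exists k
  have : CharP K p := charP_of_injective_algebraMap (algebraMap k K).injective p
  have : Fact p.Prime := ⟨CharP.char_is_prime k p⟩
  obtain ⟨t, ht, htt, _, _⟩ := DrinfeldModular.exists_separating_mem_integralOutside hK hP p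
  obtain ⟨_, _, _⟩ := DrinfeldModular.isDedekindDomain_and_finite_classGroup htt _
    (DrinfeldModular.mem_integralOutside_iff_of_mem ht htt)
  obtain ⟨e⟩ := DrinfeldModular.nonempty_cusp_equiv_classGroup (DrinfeldModular.integralOutside k P)
  have hinj := DrinfeldModular.pointStabilizer_injective (DrinfeldModular.integralOutside k P) p
  obtain ⟨τ, hτ⟩ := DrinfeldModular.exists_action_projectiveLine _ hinj
    (DrinfeldModular.exists_map_pointStabilizer_eq _ p)
  exact ⟨Finite.of_equiv _ e.symm, ⟨e⟩, hinj, DrinfeldModular.cuspClass_injective _ hinj, τ, hτ,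
    DrinfeldModular.existsUnique_action_cusp hτ hinj⟩
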